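/- Let $K$ be a field of characteristic zero. Let $\mathbb{I}_1=K\langle x,\partial,\int\rangle\subseteq \mathrm{End}_K(K[x])$ be the algebra of polynomial integro-differential operators, i.e. the $K$-subalgebra generated by multiplication by $x$, $\partial=\frac{d}{dx}$, and the integration $\int\colon x^n\mapsto \frac{x^{n+1}}{n+1}$ ($n\ge 0$); put $H:=\partial x\in\mathbb{I}_1$. A (left) $\mathbb{I}_1$-module $M$ is called a generalized weight module if $M=\bigoplus_{\lambda\in K}M^\lambda$, where $M^\lambda=\{m\in M : (H-\lambda)^n m=0 \text{ for some } n\}$; it is called indecomposable if it is nonzero and not the direct sum of two nonzero submodules. Let $B_1=K[H][\partial,\partial^{-1};\tau]$, $\tau(H)=H+1$, be the skew Laurent polynomial algebra (so $\partial^{\pm1}\alpha=\tau^{\pm1}(\alpha)\partial^{\pm1}$ for $\alpha\in K[H]$); $B_1$-modules are regarded as $\mathbb{I}_1$-modules via the algebra homomorphism $\mathbb{I}_1\to B_1$, $\partial\mapsto\partial$, $\int\mapsto\partial^{-1}$, $H\mapsto H$. For $n\ge 1$ and $\lambda\in K$ let $M(n,\lambda):=B_1\otimes_{K[H]}K[H]/((H-\lambda)^n)$.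 Let $\Lambda\subseteq K$ be any subset such that the map $\Lambda\to K/\mathbb{Z}$, $\lambda\mapsto\lambda+\mathbb{Z}$, is a bijection. Then each indecomposable generalized weight $\mathbb{I}_1$-module of finite length is isomorphic to one of the following modules: 1. $K[x]$ (with the natural action of $\mathbb{I}_1\subseteq\mathrm{End}_K(K[x])$); 2. $M(n,\lambda)$ with $n\ge 1$ and $\lambda\in\Lambda$. Moreover, the $\mathbb{I}_1$-modules in this list are pairwise non-isomorphic, indecomposable, generalized weight, and of finite length. -/

import Mathlib

open Polynomial

universe u v

noncomputable section

namespace IntDiff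

/-! ### The algebra of polynomial integro-differential operators -/

section Operators

variable (K : Type u) [Field K]

/-- Multiplication by `x` on `K[x]`. -/
def opX : Module.End K K[X] := LinearMap.mulLeft K (X : K[X])

/-- The derivation `∂ = d/dx` on `K[x]`. -/
def opD : Module.End K K[X] := Polynomial.derivative

/-- The integration on `K[x]`: the linear map with `x ^ n ↦ x ^ (n + 1) / (n + 1)`. -/
def opInt : Module.End K K[X] :=
  (Polynomial.basisMonomials K).constr K fun n => monomial (n + 1) ((n : K) + 1)⁻¹

/-- The algebra `𝕀₁ = K⟨x, ∂, ∫⟩` of polynomial integro-differential operators,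
a subalgebra of `End_K(K[x])`. -/
def I1 : Subalgebra K (Module.End K K[X]) := Algebra.adjoin K {opX K, opD K, opInt K}

theorem opX_mem : opX K ∈ I1 K := Algebra.subset_adjoin (by simp)

theorem opD_mem : opD K ∈ I1 K := Algebra.subset_adjoin (by simp)

theorem opInt_mem : opInt K ∈ I1 K := Algebra.subset_adjoin (by simp)

/-- `x` as an element of `𝕀₁`. -/
def I1.x : I1 K := ⟨opX K, opX_mem K⟩

/-- `∂` as an element of `𝕀₁`. -/
def I1.d : I1 K := ⟨opD K, opD_mem K⟩

/-- `∫` as an element of `𝕀₁`. -/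
def I1.int : I1 K := ⟨opInt K, opInt_mem K⟩

/-- `H = ∂ x` as an element of `𝕀₁`. -/
def I1.H : I1 K := I1.d K * I1.x K

theorem opInt_monomial (n : ℕ) (a : K) :
    opInt K (monomial n a) = monomial (n + 1) (a * ((n : K) + 1)⁻¹) := by
  have h : (monomial n a : K[X]) = a • Polynomial.basisMonomials K n := by
    simp [Polynomial.smul_monomial]
  rw [h, map_smul, opInt, Module.Basis.constr_basis, Polynomial.smul_monomial, smul_eq_mul]

theorem opD_monomial (n : ℕ) (a : K) :
    opD K (monomial n a) = monomial (n - 1) (a * n) :=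
  Polynomial.derivative_monomial a n

theorem opX_monomial (n : ℕ) (a : K) : opX K (monomial n a) = monomial (n + 1) a := by
  simp [opX, Polynomial.X_mul_monomial]

end Operators

/-! ### Generalized weight modules and indecomposable modules -/

section WeightModules

variable (K : Type u) [Field K] (M : Type v) [AddCommGroup M] [Module (I1 K) M]

/-- `M^l`, the elements of `M` that are annihilated by some power of `H - l`. -/
def genWeightSpace (l : K) : AddSubgroup M where
  carrier := {m | ∃ n : ℕ, (I1.H K - algebraMap K (I1 K) l) ^ n • m = 0}
  zero_mem' := ⟨0, smul_zero _⟩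
  add_mem' := by
    rintro a b ⟨n, hn⟩ ⟨m, hm⟩
    refine ⟨m + n, ?_⟩
    rw [smul_add, pow_add, mul_smul, hn, smul_zero, zero_add, ← pow_add, add_comm m n, pow_add,
      mul_smul, hm, smul_zero]
  neg_mem' := by
    rintro a ⟨n, hn⟩
    exact ⟨n, by rw [smul_neg, hn, neg_zero]⟩

open Classical in
/-- `M` is a generalized weight module: it is the direct sum of the `M^l`, `l ∈ K`. -/
def IsGenWeight : Prop := DirectSum.IsInternal (genWeightSpace K M)

end WeightModules

/-- A module is indecomposable if it is nonzero and is not the direct sum of two nonzero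
submodules. -/
def IsIndecomposable (R : Type u) [Ring R] (M : Type v) [AddCommGroup M] [Module R M] : Prop :=
  Nontrivial M ∧ ∀ P Q : Submodule R M, IsCompl P Q → P = ⊥ ∨ Q = ⊥

/-! ### The skew Laurent polynomial algebra `B₁ = K[H][∂, ∂⁻¹; τ]`, `τ(H) = H + 1` -/

section SkewLaurent

variable (K : Type u) [Field K]

/-- The automorphism `τ` of `K[H]` with `τ(H) = H + 1`. -/
def tau : K[X] ≃ₐ[K] K[X] := Polynomial.algEquivAevalXAddC 1

/-- The infinite cyclic group acts on `K[H]` through the powers of `τ`. -/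
instance tauAction : MulSemiringAction (Multiplicative ℤ) K[X] :=
  MulSemiringAction.compHom K[X] (zpowersHom (K[X] ≃ₐ[K] K[X]) (tau K))

theorem tauAction_def (g : Multiplicative ℤ) (p : K[X]) :
    g • p = (tau K ^ g.toAdd) p := rfl

instance tauAction_smulComm : SMulCommClass (Multiplicative ℤ) K K[X] where
  smul_comm g a p := by simp only [tauAction_def, map_smul]

/-- `B₁`: finite sums `∑ pᵢ ∂ ^ i`, `i ∈ ℤ`, `pᵢ ∈ K[H]`, with `∂ ^ i p = τ ^ i(p) ∂ ^ i`. -/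
abbrev B1 : Type u := SkewMonoidAlgebra K[X] (Multiplicative ℤ)

/-- The element `∂ ^ i` of `B₁`, `i ∈ ℤ`. -/
def B1.dpow (i : ℤ) : B1 K := SkewMonoidAlgebra.single (Multiplicative.ofAdd i) 1

/-- The inclusion of `K[H]` into `B₁`. -/
def B1.ofPoly : K[X] →+* B1 K := SkewMonoidAlgebra.singleOneRingHom

theorem eval_tau_zpow (i : ℤ) (p : K[X]) (c : K) :
    (((tau K) ^ i) p).eval c = p.eval (c + i) := by
  have h1 : ∀ (p : K[X]) (c : K), (tau K p).eval c = p.eval (c + 1) := by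
    intro p c
    have h : tau K p = p.comp (X + C 1) := by
      rw [Polynomial.comp_eq_aeval]; simp [tau, Polynomial.algEquivAevalXAddC]
    rw [h]; simp [Polynomial.eval_comp]
  have h2 : ∀ (p : K[X]) (c : K), ((tau K)⁻¹ p).eval c = p.eval (c - 1) := by
    intro p c
    have h := h1 ((tau K)⁻¹ p) (c - 1)
    rw [sub_add_cancel] at h
    rw [← h]
    congr 1
    exact (tau K).apply_symm_apply p
  induction i using Int.induction_on generalizing p c with
  | zero => simp
  | succ n ih =>
    rw [zpow_add_one, AlgEquiv.mul_apply, ih, h1]; push_cast; ring_nf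
  | pred n ih =>
    rw [zpow_sub_one, AlgEquiv.mul_apply, ih, h2]; push_cast; ring_nf


/-- Evaluation of the coefficient of `∂ ^ i` at `H = 1 - i`. Its joint kernel over all `i` is the
left ideal `B₁(H - 1)`, so this is the module `B₁ / B₁(H - 1)` in coordinates. -/
def B1.ev (b : B1 K) (i : ℤ) : K := (b.coeff (Multiplicative.ofAdd i)).eval (1 - (i : K))

theorem B1.ev_add (b c : B1 K) : B1.ev K (b + c) = B1.ev K b + B1.ev K c := by
  funext i; simp [B1.ev]

theorem B1.ev_sub (b c : B1 K) : B1.ev K (b - c) = B1.ev K b - B1.ev K c := by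
  funext i; simp [B1.ev]

theorem B1.ev_smul (a : K) (c : B1 K) : B1.ev K (a • c) = a • B1.ev K c := by
  funext i; simp [B1.ev]

theorem B1.ev_single_mul (j : ℤ) (q : K[X]) (c : B1 K) (i : ℤ) :
    B1.ev K (SkewMonoidAlgebra.single (Multiplicative.ofAdd j) q * c) i =
      q.eval (1 - (i : K)) * B1.ev K c (i - j) := by
  simp only [B1.ev]
  rw [SkewMonoidAlgebra.coeff_single_mul, tauAction_def, Polynomial.eval_mul, eval_tau_zpow,
    ← ofAdd_neg, ← ofAdd_add, toAdd_ofAdd, neg_add_eq_sub]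
  push_cast
  congr 2
  ring

theorem B1.ev_mul_eq_zero (b c : B1 K) (h : B1.ev K c = 0) : B1.ev K (b * c) = 0 := by
  induction b using SkewMonoidAlgebra.induction_on with
  | zero => rw [zero_mul]; funext i; simp [B1.ev]
  | single g q =>
    funext i
    have := B1.ev_single_mul K g.toAdd q c i
    rw [ofAdd_toAdd] at this
    rw [this, h]; simp
  | add f g hf hg => rw [add_mul, B1.ev_add, hf, hg, add_zero]

theorem B1.ev_mul_congr (b c c' : B1 K) (h : B1.ev K c = B1.ev K c') :
    B1.ev K (b * c) = B1.ev K (b * c') := by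
  have := B1.ev_mul_eq_zero K b (c - c') (by rw [B1.ev_sub, h, sub_self])
  rwa [mul_sub, B1.ev_sub, sub_eq_zero] at this

/-- The linear map `K[x] → B₁` with `x ^ s / s! ↦ ∂ ^ (-s)`. -/
def polyToB1 : K[X] →ₗ[K] B1 K :=
  (Polynomial.basisMonomials K).constr K fun s => (s.factorial : K) • B1.dpow K (-(s : ℤ))

theorem polyToB1_monomial (s : ℕ) (a : K) :
    polyToB1 K (monomial s a) = (a * s.factorial) • B1.dpow K (-(s : ℤ)) := by
  have h : (monomial s a : K[X]) = a • Polynomial.basisMonomials K s := by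
    simp [Polynomial.smul_monomial]
  rw [h, map_smul, polyToB1, Module.Basis.constr_basis, smul_smul]

theorem B1.ev_mul_dpow (b : B1 K) (s i : ℤ) :
    B1.ev K (b * B1.dpow K s) i =
      (b.coeff (Multiplicative.ofAdd (i - s))).eval (1 - (i : K)) := by
  simp only [B1.ev, B1.dpow]
  rw [SkewMonoidAlgebra.coeff_mul_single, smul_one, mul_one, ← ofAdd_neg, ← ofAdd_add,
    ← sub_eq_add_neg]

/-- The pairs `(a, b)` in `End_K(K[x]) × B₁` for which `a` is continuous in the `x`-adic topology
and acts as `b` on all the polynomials that are divisible by a high power of `x`. -/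
def compatible : Subalgebra K (Module.End K K[X] × B1 K) where
  carrier := {t | (∀ N : ℕ, ∃ m : ℕ, ∀ p : K[X], X ^ m ∣ p → X ^ N ∣ t.1 p) ∧
    ∃ N : ℕ, ∀ p : K[X], X ^ N ∣ p →
      B1.ev K (t.2 * polyToB1 K p) = B1.ev K (polyToB1 K (t.1 p))}
  mul_mem' := by
    rintro ⟨a, b⟩ ⟨a', b'⟩ ⟨h1, N, h2⟩ ⟨h1', N', h2'⟩
    refine ⟨fun k => ?_, ?_⟩
    · obtain ⟨m, hm⟩ := h1 k
      obtain ⟨m', hm'⟩ := h1' m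
      exact ⟨m', fun p hp => hm _ (hm' p hp)⟩
    · obtain ⟨m, hm⟩ := h1' N
      refine ⟨max m N', fun p hp => ?_⟩
      have hp1 : X ^ m ∣ p := (pow_dvd_pow _ (le_max_left _ _)).trans hp
      have hp2 : X ^ N' ∣ p := (pow_dvd_pow _ (le_max_right _ _)).trans hp
      change B1.ev K (b * b' * polyToB1 K p) = B1.ev K (polyToB1 K (a (a' p)))
      rw [← h2 (a' p) (hm p hp1), mul_assoc]
      exact B1.ev_mul_congr K b _ _ (h2' p hp2)
  add_mem' := by
    rintro ⟨a, b⟩ ⟨a', b'⟩ ⟨h1, N, h2⟩ ⟨h1', N', h2'⟩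
    refine ⟨fun k => ?_, max N N', fun p hp => ?_⟩
    · obtain ⟨m, hm⟩ := h1 k
      obtain ⟨m', hm'⟩ := h1' k
      exact ⟨max m m', fun p hp => dvd_add
        (hm p ((pow_dvd_pow _ (le_max_left _ _)).trans hp))
        (hm' p ((pow_dvd_pow _ (le_max_right _ _)).trans hp))⟩
    · have e1 := h2 p ((pow_dvd_pow _ (le_max_left _ _)).trans hp)
      have e2 := h2' p ((pow_dvd_pow _ (le_max_right _ _)).trans hp)
      change B1.ev K ((b + b') * polyToB1 K p) = B1.ev K (polyToB1 K (a p + a' p))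
      rw [add_mul, B1.ev_add, map_add, B1.ev_add]
      exact congrArg₂ _ e1 e2
  algebraMap_mem' := by
    intro r
    refine ⟨fun N => ⟨N, fun p hp => ?_⟩, 0, fun p _ => ?_⟩
    · change X ^ N ∣ r • p
      rw [Polynomial.smul_eq_C_mul]; exact hp.mul_left _
    · change B1.ev K (algebraMap K (B1 K) r * polyToB1 K p) = B1.ev K (polyToB1 K (r • p))
      rw [map_smul, Algebra.smul_def]

theorem dvd_induction {P : K[X] → Prop} (N : ℕ) (hadd : ∀ p q, P p → P q → P (p + q))
    (hmon : ∀ s, N ≤ s → ∀ c : K, P (monomial s c)) (p : K[X]) (hp : X ^ N ∣ p) : P p := by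
  obtain ⟨q, rfl⟩ := hp
  induction q using Polynomial.induction_on' with
  | add f g hf hg => rw [mul_add]; exact hadd _ _ hf hg
  | monomial n c =>
    rw [Polynomial.X_pow_mul_monomial]
    exact hmon _ (Nat.le_add_left _ _) c

theorem compatible_of_monomial (a : Module.End K K[X]) (b : B1 K) (N : ℕ)
    (h : ∀ s, N ≤ s → ∀ c : K, B1.ev K (b * polyToB1 K (monomial s c)) =
      B1.ev K (polyToB1 K (a (monomial s c)))) (p : K[X]) (hp : X ^ N ∣ p) :
    B1.ev K (b * polyToB1 K p) = B1.ev K (polyToB1 K (a p)) := by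
  refine dvd_induction K (P := fun p => B1.ev K (b * polyToB1 K p) = B1.ev K (polyToB1 K (a p)))
    N (fun p q hp hq => ?_) h p hp
  simp only [map_add, mul_add, B1.ev_add, hp, hq]

theorem B1.dpow_mul_dpow (i j : ℤ) : B1.dpow K i * B1.dpow K j = B1.dpow K (i + j) := by
  simp [B1.dpow, SkewMonoidAlgebra.single_mul_single, ofAdd_add]

theorem B1.ev_dpow (i j : ℤ) : B1.ev K (B1.dpow K i) j = if i = j then 1 else 0 := by
  classical
  simp only [B1.ev, B1.dpow, SkewMonoidAlgebra.coeff_single_apply]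
  split_ifs <;> simp_all

theorem compatible_x : (opX K, B1.dpow K (-1) * B1.ofPoly K X) ∈ compatible K := by
  refine ⟨fun N => ⟨N, fun p hp => hp.mul_left X⟩, 0,
    compatible_of_monomial K _ _ 0 fun s _ c => ?_⟩
  rw [opX_monomial, polyToB1_monomial, polyToB1_monomial, mul_smul_comm, B1.ev_smul, B1.ev_smul]
  funext i
  have e : B1.ofPoly K X = SkewMonoidAlgebra.single (Multiplicative.ofAdd 0) X := rfl
  rw [mul_assoc, Pi.smul_apply, Pi.smul_apply, e]
  nth_rewrite 1 [B1.dpow]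
  rw [B1.ev_single_mul, B1.ev_single_mul, B1.ev_dpow, B1.ev_dpow]
  by_cases hi : i = -((s : ℤ) + 1)
  · subst hi
    simp [Nat.factorial_succ]
    ring
  · rw [if_neg (by omega), if_neg (by push_cast; omega)]
    simp

theorem compatible_d : (opD K, B1.dpow K 1) ∈ compatible K := by
  refine ⟨fun N => ⟨N + 1, fun p hp => ?_⟩, 1, compatible_of_monomial K _ _ 1 fun s hs c => ?_⟩
  · have h := Polynomial.pow_sub_one_dvd_derivative_of_pow_dvd hp
    rw [Nat.add_sub_cancel] at h
    exact h
  · obtain ⟨t, rfl⟩ := Nat.exists_eq_add_of_le' hs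
    rw [opD_monomial, polyToB1_monomial, polyToB1_monomial, mul_smul_comm, B1.dpow_mul_dpow]
    congr 2
    · simp [Nat.factorial_succ]; ring
    · congr 1; push_cast; simp

theorem compatible_int [CharZero K] : (opInt K, B1.dpow K (-1)) ∈ compatible K := by
  refine ⟨fun N => ⟨N, dvd_induction K N (fun p q hp hq => ?_) fun s hs c => ?_⟩, 0,
    compatible_of_monomial K _ _ 0 fun s _ c => ?_⟩
  · simp only [map_add]; exact dvd_add hp hq
  · rw [opInt_monomial, ← Polynomial.C_mul_X_pow_eq_monomial]
    exact (pow_dvd_pow X (by omega)).mul_left _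
  · rw [opInt_monomial, polyToB1_monomial, polyToB1_monomial, mul_smul_comm, B1.dpow_mul_dpow]
    have : (s : K) + 1 ≠ 0 := by exact_mod_cast Nat.succ_ne_zero s
    congr 2
    · simp [Nat.factorial_succ]; field_simp
    · congr 1; push_cast; ring

theorem compatible_zero [CharZero K] (b : B1 K) (h : (0, b) ∈ compatible K) : b = 0 := by
  obtain ⟨-, N, h⟩ := h
  ext1 g
  refine Polynomial.eq_zero_of_infinite_isRoot _ ?_
  have hr : ∀ k : ℕ, (1 - (g.toAdd : K) + ((k + N : ℕ) : K)) ∈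
      {x | Polynomial.IsRoot (b.coeff g) x} := by
    intro k
    have h1 := h (monomial (k + N) 1) (by
      rw [← Polynomial.C_mul_X_pow_eq_monomial]
      exact (pow_dvd_pow X (by omega)).mul_left _)
    have h2 := congrFun h1 (g.toAdd - ((k + N : ℕ) : ℤ))
    rw [polyToB1_monomial, mul_smul_comm, B1.ev_smul, Pi.smul_apply, B1.ev_mul_dpow] at h2
    have h3 : B1.ev K (polyToB1 K ((0 : Module.End K K[X]) (monomial (k + N) 1)))
        (g.toAdd - ((k + N : ℕ) : ℤ)) = 0 := by simp [B1.ev]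
    rw [h3, smul_eq_zero] at h2
    have h4 := h2.resolve_left (by
      rw [one_mul]; exact_mod_cast Nat.factorial_ne_zero _)
    rw [sub_neg_eq_add, sub_add_cancel, ofAdd_toAdd] at h4
    rw [Set.mem_ofPred_eq, Polynomial.IsRoot.def, ← h4]
    congr 1
    push_cast
    ring
  refine Set.infinite_of_injective_forall_mem (fun k k' hk => ?_) hr
  have := add_left_cancel hk
  have := Nat.cast_injective this
  omega

/-- The first projection of the algebra of compatible pairs. -/
def compatibleFst : compatible K →ₐ[K] Module.End K K[X] :=
  (AlgHom.fst K (Module.End K K[X]) (B1 K)).comp (compatible K).val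

theorem compatibleFst_injective [CharZero K] : Function.Injective (compatibleFst K) := by
  rw [injective_iff_map_eq_zero]
  rintro ⟨⟨a, b⟩, h⟩ (h0 : a = 0)
  subst h0
  have := compatible_zero K b h
  subst this
  rfl

theorem I1_le_range [CharZero K] : I1 K ≤ (compatibleFst K).range := by
  refine Algebra.adjoin_le ?_
  rintro _ (rfl | rfl | rfl)
  · exact ⟨⟨_, compatible_x K⟩, rfl⟩
  · exact ⟨⟨_, compatible_d K⟩, rfl⟩
  · exact ⟨⟨_, compatible_int K⟩, rfl⟩

/-- The canonical epimorphism `𝕀₁ → B₁`: the unique algebra homomorphism with `∂ ↦ ∂`,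
`∫ ↦ ∂⁻¹`, `H ↦ H` (note `x = ∫ H`), obtained by sending `a` to the unique `b` such that `(a, b)`
is compatible; see `toB1_d`, `toB1_int`, `toB1_H`. -/
def toB1 [CharZero K] : I1 K →ₐ[K] B1 K :=
  ((AlgHom.snd K (Module.End K K[X]) (B1 K)).comp (compatible K).val).comp
    (((AlgEquiv.ofInjective (compatibleFst K) (compatibleFst_injective K)).symm :
      (compatibleFst K).range →ₐ[K] compatible K).comp (Subalgebra.inclusion (I1_le_range K)))

theorem toB1_eq [CharZero K] (a : I1 K) (b : B1 K)
    (h : ((a : Module.End K K[X]), b) ∈ compatible K) :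
    toB1 K a = b := by
  have : (AlgEquiv.ofInjective (compatibleFst K) (compatibleFst_injective K)).symm
      (Subalgebra.inclusion (I1_le_range K) a) = ⟨(a, b), h⟩ := by
    rw [AlgEquiv.symm_apply_eq]; rfl
  change ((AlgEquiv.ofInjective (compatibleFst K) (compatibleFst_injective K)).symm
      (Subalgebra.inclusion (I1_le_range K) a)).1.2 = b
  rw [this]

theorem toB1_x [CharZero K] : toB1 K (I1.x K) = B1.dpow K (-1) * B1.ofPoly K X :=
  toB1_eq K _ _ (compatible_x K)

theorem toB1_d [CharZero K] : toB1 K (I1.d K) = B1.dpow K 1 := toB1_eq K _ _ (compatible_d K)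

theorem toB1_int [CharZero K] : toB1 K (I1.int K) = B1.dpow K (-1) :=
  toB1_eq K _ _ (compatible_int K)

theorem toB1_H [CharZero K] : toB1 K (I1.H K) = B1.ofPoly K X := by
  have h : B1.dpow K 0 = 1 := rfl
  rw [I1.H, map_mul, toB1_d, toB1_x, ← mul_assoc, B1.dpow_mul_dpow, add_neg_cancel, h, one_mul]

end SkewLaurent

/-! ### The modules `M(n, l)` -/

section Modules

variable (K : Type u) [Field K]

/-- `B₁` as a `(B₁, K[H])`-bimodule: `B₁` acts by left multiplication, and the commutative ring
`K[H]` by right multiplication, `p • b = b p`. -/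
def B1Right : Type u := B1 K

instance : AddCommGroup (B1Right K) := inferInstanceAs (AddCommGroup (B1 K))

instance : Module (B1 K) (B1Right K) := inferInstanceAs (Module (B1 K) (B1 K))

instance : Module K[X] (B1Right K) where
  smul p b := (show B1 K from b) * B1.ofPoly K p
  one_smul b := by
    change (show B1 K from b) * B1.ofPoly K 1 = b
    rw [map_one]; exact mul_one _
  mul_smul p q b := by
    change (show B1 K from b) * B1.ofPoly K (p * q) =
      (show B1 K from b) * B1.ofPoly K q * B1.ofPoly K p
    rw [mul_comm p q, map_mul, mul_assoc]
  smul_zero p := zero_mul (B1.ofPoly K p)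
  smul_add p b c := add_mul (show B1 K from b) (show B1 K from c) (B1.ofPoly K p)
  add_smul p q b := by
    change (show B1 K from b) * B1.ofPoly K (p + q) =
      (show B1 K from b) * B1.ofPoly K p + (show B1 K from b) * B1.ofPoly K q
    rw [map_add, mul_add]
  zero_smul b := by
    change (show B1 K from b) * B1.ofPoly K 0 = (0 : B1 K)
    rw [map_zero, mul_zero]

instance : SMulCommClass K[X] (B1 K) (B1Right K) where
  smul_comm p b c := mul_assoc b (show B1 K from c) (B1.ofPoly K p)

/-- `M(n, l) = B₁ ⊗_{K[H]} K[H] / (H - l) ^ n`. -/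
def Mod (n : ℕ) (l : K) : Type u :=
  TensorProduct K[X] (B1Right K) (K[X] ⧸ Ideal.span {(X - C l : K[X]) ^ n})

instance (n : ℕ) (l : K) : AddCommGroup (Mod K n l) :=
  inferInstanceAs (AddCommGroup
    (TensorProduct K[X] (B1Right K) (K[X] ⧸ Ideal.span {(X - C l : K[X]) ^ n})))

/-- The `B₁`-module structure of `M(n, l)`, on the left factor. -/
instance (n : ℕ) (l : K) : Module (B1 K) (Mod K n l) :=
  inferInstanceAs (Module (B1 K)
    (TensorProduct K[X] (B1Right K) (K[X] ⧸ Ideal.span {(X - C l : K[X]) ^ n})))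

/-- `M(n, l)` as an `𝕀₁`-module, along `𝕀₁ → B₁`. -/
instance [CharZero K] (n : ℕ) (l : K) : Module (I1 K) (Mod K n l) :=
  Module.compHom (Mod K n l) (toB1 K).toRingHom

end Modules

end IntDiff

end

noncomputable section

namespace IntDiff

/-! ### Relations in `𝕀₁` -/

section Relations

variable (K : Type u) [Field K]

/-! The generators `∂`, `∫`, `H` satisfy `∂∫ = 1`, `∂H = (H + 1)∂`, `H∫ = ∫(H + 1)` and `(1 - ∫∂)H =
1 - ∫∂`; `IntDiffAlgebra` records these relations, and most of the proof uses nothing else. Let `M`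
be an indecomposable generalized weight module of finite length.

If `∂v = 0` for some `v ≠ 0`, then `xⁿ/n! ↦ ∫ⁿv` embeds `K[x]` in `M`
(`exists_hom_of_d_smul_eq_zero`). A Taylor expansion `m ↦ ∑ g((1 - ∫∂)∂ᵏm) xᵏ/k!`, with a functional
`g` such that `g(v) = 1`, is a left inverse (`exists_taylor`). So `K[x]` splits off, and `M ≅ K[x]`.

If `∂` is injective, then `∂∫ = 1` makes it invertible. Indecomposability puts all weights in one
coset `l + ℤ`, and the powers of `∂` identify the weight spaces. Hence `M` is governed by the
`K[H]`-module `M^l`: the `H`-stable subspaces `S` of `M^l` correspond to the submodules `⊕ᵢ ∂ⁱS`.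
The Noetherian condition bounds the order of `H - l` on `M^l`, and a vector `u` of maximal order `n`
generates a direct summand `K[H]u` (`exists_complement_orbit`). By indecomposability `M^l = K[H]u`,
a situation recorded by `IsCyclicWeight`.

Such a module is determined up to isomorphism by `n ≥ 1` and `l` (`IsCyclicWeight.nonempty_equiv`),
and `M(n, l)` is one of them. Every nonzero submodule contains `(H - l)ⁿ⁻¹u`, which gives
indecomposability. The coset of `l` and the order `n` are isomorphism invariants, and invertibility
of `∂` separates these modules from `K[x]`. -/

theorem I1.H_apply_monomial (n : ℕ) (a : K) :
    (I1.H K : Module.End K K[X]) (monomial n a) = monomial n (a * (n + 1)) := by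
  change opD K (opX K (monomial n a)) = _
  rw [opX_monomial, opD_monomial, Nat.add_sub_cancel, Nat.cast_succ]

theorem I1.ext_monomial {a b : I1 K}
    (h : ∀ (n : ℕ) (c : K), (a : Module.End K K[X]) (monomial n c) =
      (b : Module.End K K[X]) (monomial n c)) : a = b :=
  Subtype.ext (Polynomial.lhom_ext' fun n => LinearMap.ext fun c => h n c)

theorem I1.d_mul_H : I1.d K * I1.H K = (I1.H K + 1) * I1.d K := by
  refine I1.ext_monomial K fun n c => ?_
  change opD K ((I1.H K : Module.End K K[X]) _) = (I1.H K : Module.End K K[X]) (opD K _) + opD K _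
  rw [I1.H_apply_monomial, opD_monomial, opD_monomial, I1.H_apply_monomial, ← map_add]
  rcases n with _ | n
  · simp
  · congr 1
    push_cast [Nat.add_sub_cancel]
    ring

variable [CharZero K]

theorem I1.d_mul_int : I1.d K * I1.int K = 1 := by
  refine I1.ext_monomial K fun n c => ?_
  change opD K (opInt K (monomial n c)) = monomial n c
  rw [opInt_monomial, opD_monomial, Nat.add_sub_cancel, Nat.cast_succ,
    inv_mul_cancel_right₀ (Nat.cast_add_one_ne_zero n)]

theorem I1.int_mul_H : I1.int K * I1.H K = I1.x K := by
  refine I1.ext_monomial K fun n c => ?_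
  change opInt K ((I1.H K : Module.End K K[X]) _) = opX K _
  rw [I1.H_apply_monomial, opInt_monomial, opX_monomial,
    mul_inv_cancel_right₀ (Nat.cast_add_one_ne_zero n)]

theorem I1.H_mul_int : I1.H K * I1.int K = I1.int K * (I1.H K + 1) := by
  refine I1.ext_monomial K fun n c => ?_
  change (I1.H K : Module.End K K[X]) (opInt K _) =
    opInt K ((I1.H K : Module.End K K[X]) _ + monomial n c)
  rw [I1.H_apply_monomial, opInt_monomial, I1.H_apply_monomial, map_add, opInt_monomial,
    opInt_monomial, ← map_add]
  congr 1
  have := Nat.cast_add_one_ne_zero (R := K) n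
  push_cast
  field_simp

/-- The idempotent `1 - ∫∂` is the evaluation at `0`, so it absorbs `H`. -/
theorem I1.one_sub_int_mul_d_mul_H :
    (1 - I1.int K * I1.d K) * I1.H K = 1 - I1.int K * I1.d K := by
  refine I1.ext_monomial K fun n c => ?_
  change (I1.H K : Module.End K K[X]) _ - opInt K (opD K ((I1.H K : Module.End K K[X]) _)) =
    monomial n c - opInt K (opD K (monomial n c))
  rw [I1.H_apply_monomial, opD_monomial, opD_monomial, opInt_monomial, opInt_monomial]
  rcases n with _ | n
  · simp
  · have := Nat.cast_add_one_ne_zero (R := K) n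
    rw [← sub_eq_zero, Nat.add_sub_cancel]
    rw [sub_eq_zero.2 (congrArg _ ?_), sub_eq_zero.2 (congrArg _ ?_), sub_self] <;>
    · push_cast
      field_simp

end Relations

/-- A `K`-algebra generated by elements `∂`, `∫`, `H` that satisfy the relations of `𝕀₁`. -/
class IntDiffAlgebra (K : Type*) (A : Type*) [Field K] [Ring A] [Algebra K A] where
  /-- the derivation -/
  d : A
  /-- the integration -/
  J : A
  /-- the weight operator -/
  H : A
  d_mul_J : d * J = 1
  d_mul_H : d * H = (H + 1) * d
  H_mul_J : H * J = J * (H + 1)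
  one_sub_mul_H : (1 - J * d) * H = 1 - J * d
  generated : ∀ p : A → Prop, p d → p J → p H → (∀ c, p (algebraMap K A c)) →
    (∀ a b, p a → p b → p (a + b)) → (∀ a b, p a → p b → p (a * b)) → ∀ a, p a

instance (K : Type u) [Field K] [CharZero K] : IntDiffAlgebra K (I1 K) where
  d := I1.d K
  J := I1.int K
  H := I1.H K
  d_mul_J := I1.d_mul_int K
  d_mul_H := I1.d_mul_H K
  H_mul_J := I1.H_mul_int K
  one_sub_mul_H := I1.one_sub_int_mul_d_mul_H K
  generated p hd hJ hH halg hadd hmul := by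
    rintro ⟨a, ha⟩
    induction ha using Algebra.adjoin_induction with
    | mem a ha =>
      rcases ha with rfl | rfl | rfl
      -- The generator `x` is redundant because `x = ∫H`.
      · have h := hmul _ _ hJ hH
        rwa [I1.int_mul_H] at h
      · exact hd
      · exact hJ
    | algebraMap c => exact halg c
    | add a b ha hb h h' => exact hadd _ _ h h'
    | mul a b ha hb h h' => exact hmul _ _ h h'

open IntDiffAlgebra

/-! ### Constructions with modules that only need the generators -/

section Generators

variable {K : Type*} [Field K] {A : Type*} [Ring A] [Algebra K A] [IntDiffAlgebra K A]
variable {M : Type*} [AddCommGroup M] [Module K M] [Module A M] [IsScalarTower K A M]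
variable {N : Type*} [AddCommGroup N] [Module K N] [Module A N] [IsScalarTower K A N]

variable (A) in
/-- A subspace that is stable under `∂`, `∫` and `H`, as a submodule. -/
def stableSubmodule (S : Submodule K M) (hd : ∀ m ∈ S, d K (A := A) • m ∈ S)
    (hJ : ∀ m ∈ S, J K (A := A) • m ∈ S) (hH : ∀ m ∈ S, H K (A := A) • m ∈ S) :
    Submodule A M where
  __ := S.toAddSubmonoid
  smul_mem' a m hm := by
    refine generated (K := K) (fun a => ∀ m ∈ S, a • m ∈ S) hd hJ hH (fun c m hm => ?_)
      (fun a b ha hb m hm => ?_) (fun a b ha hb m hm => ?_) a m hm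
    · rw [algebraMap_smul]; exact S.smul_mem c hm
    · rw [add_smul]; exact S.add_mem (ha m hm) (hb m hm)
    · rw [mul_smul]; exact ha _ (hb m hm)

variable (A) in
/-- A linear map that commutes with `∂`, `∫` and `H`, as a homomorphism of modules. -/
def homOfCommute (f : M →ₗ[K] N) (hd : ∀ m, f (d K (A := A) • m) = d K (A := A) • f m)
    (hJ : ∀ m, f (J K (A := A) • m) = J K (A := A) • f m)
    (hH : ∀ m, f (H K (A := A) • m) = H K (A := A) • f m) : M →ₗ[A] N where
  __ := f.toAddHom
  map_smul' a m := by
    refine generated (K := K) (fun a => ∀ m, f (a • m) = a • f m) hd hJ hH (fun c m => ?_)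
      (fun a b ha hb m => ?_) (fun a b ha hb m => ?_) a m
    · rw [algebraMap_smul, algebraMap_smul, map_smul]
    · rw [add_smul, add_smul, map_add, ha, hb]
    · rw [mul_smul, mul_smul, ha, hb]

theorem homOfCommute_apply (f : M →ₗ[K] N) (hd hJ hH) (m : M) :
    homOfCommute A f hd hJ hH m = f m := rfl

end Generators

/-! ### Weight spaces as generalized eigenspaces -/

section Weights

variable {K : Type*} [Field K] {A : Type*} [Ring A] [Algebra K A]
variable {M : Type*} [AddCommGroup M] [Module K M] [Module A M] [IsScalarTower K A M]

variable (K A M) in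
/-- The action of `A` by linear maps. -/
def act : A →ₐ[K] Module.End K M := Algebra.lsmul K K M

@[simp]
theorem act_apply (a : A) (m : M) : act K A M a m = a • m := rfl

variable [IntDiffAlgebra K A]

variable (A) in
/-- The operator `H - l`. -/
def T (l : K) : A := H K - algebraMap K A l

theorem act_sub_pow (l : K) (n : ℕ) (m : M) :
    ((act K A M (H K) - l • 1) ^ n) m = T A l ^ n • m := by
  have : act K A M (H K) - l • 1 = act K A M (T A l) := by
    rw [T, map_sub, AlgHom.commutes, Algebra.algebraMap_eq_smul_one]
  rw [this, ← map_pow, act_apply]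

variable (A M) in
/-- The generalized weight space of weight `l` as a linear subspace. -/
def weight (l : K) : Submodule K M := (act K A M (H K)).maxGenEigenspace l

theorem mem_weight {l : K} {m : M} : m ∈ weight A M l ↔ ∃ n : ℕ, T A l ^ n • m = 0 := by
  simp_rw [weight, Module.End.mem_maxGenEigenspace, act_sub_pow]

variable (K A M) in
theorem iSupIndep_weight : iSupIndep (weight (K := K) A M) :=
  Module.End.independent_maxGenEigenspace _

/-- Intertwining passes to powers, so `a` carries a vector killed by `(H - l)ⁿ` to one killed by `(H
- l')ⁿ`. -/
theorem weight_le_comap {a : A} {l l' : K} (h : SemiconjBy a (T A l) (T A l')) :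
    weight A M l ≤ (weight A M l').comap (act K A M a) := by
  intro m hm
  obtain ⟨n, hn⟩ := mem_weight.1 hm
  refine mem_weight.2 ⟨n, ?_⟩
  rw [act_apply, ← mul_smul, ← (h.pow_right n).eq, mul_smul, hn, smul_zero]

theorem H_commute_T (l : K) : Commute (H K : A) (T A l) :=
  (Commute.refl _).sub_right (Algebra.commute_algebraMap_right _ _)

theorem d_semiconj_T (l : K) : SemiconjBy (d K : A) (T A l) (T A (l - 1)) := by
  rw [SemiconjBy, T, T, mul_sub, d_mul_H, map_sub, map_one, ← Algebra.commutes]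
  noncomm_ring

theorem J_semiconj_T (l : K) : SemiconjBy (J K : A) (T A l) (T A (l + 1)) := by
  rw [SemiconjBy, T, T, sub_mul, H_mul_J, map_add, map_one, add_mul, Algebra.commutes]
  noncomm_ring

theorem H_smul_mem_weight {l : K} {m : M} (hm : m ∈ weight A M l) :
    H K (A := A) • m ∈ weight A M l :=
  weight_le_comap (H_commute_T l) hm

theorem d_smul_mem_weight {l : K} {m : M} (hm : m ∈ weight A M l) :
    d K (A := A) • m ∈ weight A M (l - 1) :=
  weight_le_comap (d_semiconj_T l) hm

theorem J_smul_mem_weight {l : K} {m : M} (hm : m ∈ weight A M l) :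
    J K (A := A) • m ∈ weight A M (l + 1) :=
  weight_le_comap (J_semiconj_T l) hm

/-- The weight components of an element of a submodule lie in the submodule. -/
theorem mem_of_sum_mem {ι : Type*} {w : ι → K} (hw : w.Injective) (N : Submodule A M)
    (f : ι →₀ M) (hf : ∀ i, f i ∈ weight A M (w i)) (h : (f.sum fun _ m => m) ∈ N) (i : ι) :
    f i ∈ N := by
  -- Independence is applied in `M ⧸ N`: the images of the components are weight vectors there with
  -- sum zero, so each of them vanishes.
  have hi := (iSupIndep_iff_finsetSum_eq_zero_imp_eq_zero _).1
    ((iSupIndep_weight K A (M ⧸ N)).comp hw)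
  by_cases hl : i ∈ f.support
  · rw [← Submodule.Quotient.mk_eq_zero]
    refine hi f.support (fun i => N.mkQ (f i)) (fun i _ => ?_) ?_ i hl
    · obtain ⟨n, hn⟩ := mem_weight.1 (hf i)
      exact mem_weight.2 ⟨n, by rw [← map_smul, hn, map_zero]⟩
    · rw [← map_sum]
      exact (Submodule.Quotient.mk_eq_zero N).2 h
  · rw [Finsupp.notMem_support_iff.1 hl]
    exact N.zero_mem

end Weights

/-- Generalized eigenspaces of one operator are always independent, so only spanning remains as a
condition. -/
theorem isGenWeight_iff {K : Type u} [Field K] [CharZero K] {M : Type*} [AddCommGroup M]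
    [Module K M] [Module (I1 K) M] [IsScalarTower K (I1 K) M] :
    IsGenWeight K M ↔ ⨆ l : K, weight (I1 K) M l = ⊤ := by
  classical
  have h : genWeightSpace K M = fun l => (weight (I1 K) M l).toAddSubgroup := by
    funext l
    ext m
    exact (mem_weight (A := I1 K) (M := M) (l := l) (m := m)).symm
  have h1 : IsGenWeight K M ↔ DirectSum.IsInternal (weight (K := K) (I1 K) M) := by
    unfold IsGenWeight
    rw [h]
    refine iff_of_eq ?_
    unfold DirectSum.IsInternal
    congr!
  rw [h1, DirectSum.isInternal_submodule_iff_iSupIndep_and_iSup_eq_top]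
  exact and_iff_right (iSupIndep_weight K (I1 K) M)

/-! ### Modules on which `∂` is invertible -/

theorem sub_intCast_injective {K : Type*} [Field K] [CharZero K] (l : K) :
    Function.Injective fun i : ℤ => l - i :=
  fun _ _ hij => Int.cast_injective (sub_right_injective hij)

section Shift

variable {K : Type*} [Field K] {A : Type*} [Ring A] [Algebra K A] [IntDiffAlgebra K A]
variable {M : Type*} [AddCommGroup M] [Module A M]

theorem d_smul_J_smul (m : M) : d K (A := A) • J K (A := A) • m = m := by
  rw [← mul_smul, d_mul_J, one_smul]

/-- Since `∂∫ = 1`, the operator `∂` kills `∫∂m - m`. -/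
theorem J_smul_d_smul_of_injective (h : ∀ m : M, d K (A := A) • m = 0 → m = 0) (m : M) :
    J K (A := A) • d K (A := A) • m = m := by
  rw [← sub_eq_zero]
  apply h
  rw [smul_sub, d_smul_J_smul, sub_self]

variable (K A M) in
/-- `∂` acts invertibly. -/
def DInvertible : Prop := ∀ m : M, J K (A := A) • d K (A := A) • m = m

variable [Module K M] [IsScalarTower K A M]

/-- The action of `∂` as a unit. -/
def DInvertible.shift (h : DInvertible K A M) : (Module.End K M)ˣ where
  val := act K A M (d K)
  inv := act K A M (J K)
  val_inv := LinearMap.ext d_smul_J_smul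
  inv_val := LinearMap.ext h

variable (h : DInvertible K A M)

namespace DInvertible

theorem shift_apply (m : M) : h.shift.val m = d K (A := A) • m := rfl

theorem shift_inv_apply (m : M) : (h.shift⁻¹).val m = J K (A := A) • m := rfl

theorem shift_zpow_add_one_apply (i : ℤ) (m : M) :
    (h.shift ^ (i + 1)).val m = (h.shift ^ i).val (d K (A := A) • m) := by
  rw [zpow_add_one, Units.val_mul, Module.End.mul_apply, shift_apply]

theorem shift_zpow_sub_one_apply (i : ℤ) (m : M) :
    (h.shift ^ (i - 1)).val m = (h.shift ^ i).val (J K (A := A) • m) := by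
  rw [zpow_sub_one, Units.val_mul, Module.End.mul_apply, shift_inv_apply]

theorem d_smul_shift_zpow (i : ℤ) (m : M) :
    d K (A := A) • (h.shift ^ i).val m = (h.shift ^ (i + 1)).val m := by
  rw [add_comm, zpow_one_add, Units.val_mul, Module.End.mul_apply, shift_apply]

theorem J_smul_shift_zpow (i : ℤ) (m : M) :
    J K (A := A) • (h.shift ^ i).val m = (h.shift ^ (i - 1)).val m := by
  rw [← neg_add_eq_sub, zpow_add, zpow_neg_one, Units.val_mul, Module.End.mul_apply,
    shift_inv_apply]

theorem shift_zpow_neg_apply (i : ℤ) (m : M) :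
    (h.shift ^ (-i)).val ((h.shift ^ i).val m) = m := by
  rw [← Module.End.mul_apply, ← Units.val_mul, ← zpow_add, neg_add_cancel, zpow_zero]
  rfl

/-- This commutation rule makes `∂ⁱS` stable under `H` whenever `S` is. -/
theorem H_smul_shift_zpow (i : ℤ) (m : M) :
    H K (A := A) • (h.shift ^ i).val m =
      (h.shift ^ i).val (H K (A := A) • m) - (i : K) • (h.shift ^ i).val m := by
  induction i using Int.induction_on generalizing m with
  | zero => simp
  | succ i ih =>
    have e : H K (A := A) • d K (A := A) • m =
        d K (A := A) • H K (A := A) • m - d K (A := A) • m := by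
      rw [← mul_smul, ← mul_smul, d_mul_H, add_mul, one_mul, add_smul, add_sub_cancel_right]
    rw [shift_zpow_add_one_apply, ih, e, map_sub, ← shift_zpow_add_one_apply,
      ← shift_zpow_add_one_apply]
    push_cast
    module
  | pred i ih =>
    have e : H K (A := A) • J K (A := A) • m =
        J K (A := A) • H K (A := A) • m + J K (A := A) • m := by
      rw [← mul_smul, ← mul_smul, H_mul_J, mul_add, mul_one, add_smul]
    rw [shift_zpow_sub_one_apply, ih, e, map_add, ← shift_zpow_sub_one_apply,
      ← shift_zpow_sub_one_apply]
    push_cast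
    module

theorem shift_zpow_mem_weight (i : ℤ) {l : K} {m : M} (hm : m ∈ weight A M l) :
    (h.shift ^ i).val m ∈ weight A M (l - i) := by
  induction i using Int.induction_on generalizing m l with
  | zero => simpa using hm
  | succ i ih =>
    rw [shift_zpow_add_one_apply]
    convert! ih (d_smul_mem_weight hm) using 2
    push_cast
    ring
  | pred i ih =>
    rw [shift_zpow_sub_one_apply]
    convert! ih (J_smul_mem_weight hm) using 2
    push_cast
    ring

theorem shift_zpow_mem (i : ℤ) {N : Submodule A M} {m : M} (hm : m ∈ N) :
    (h.shift ^ i).val m ∈ N := by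
  induction i using Int.induction_on generalizing m with
  | zero => simpa using hm
  | succ i ih =>
    rw [shift_zpow_add_one_apply]
    exact ih (N.smul_mem _ hm)
  | pred i ih =>
    rw [shift_zpow_sub_one_apply]
    exact ih (N.smul_mem _ hm)

/-- The submodule `⊕ᵢ ∂ⁱ S` generated by an `H`-stable subspace `S`. -/
def induced (S : Submodule K M) (hS : ∀ m ∈ S, H K (A := A) • m ∈ S) : Submodule A M :=
  stableSubmodule A (⨆ i : ℤ, S.map (h.shift ^ i).val)
    (fun m hm => by
      refine (iSup_le fun i => ?_ : _ ≤ Submodule.comap (act K A M (d K))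
        (⨆ i : ℤ, S.map (h.shift ^ i).val)) hm
      rintro _ ⟨m, hm, rfl⟩
      rw [Submodule.mem_comap, act_apply, d_smul_shift_zpow]
      exact Submodule.mem_iSup_of_mem (i + 1) ⟨m, hm, rfl⟩)
    (fun m hm => by
      refine (iSup_le fun i => ?_ : _ ≤ Submodule.comap (act K A M (J K))
        (⨆ i : ℤ, S.map (h.shift ^ i).val)) hm
      rintro _ ⟨m, hm, rfl⟩
      rw [Submodule.mem_comap, act_apply, J_smul_shift_zpow]
      exact Submodule.mem_iSup_of_mem (i - 1) ⟨m, hm, rfl⟩)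
    (fun m hm => by
      refine (iSup_le fun i => ?_ : _ ≤ Submodule.comap (act K A M (H K))
        (⨆ i : ℤ, S.map (h.shift ^ i).val)) hm
      rintro _ ⟨m, hm, rfl⟩
      rw [Submodule.mem_comap, act_apply, H_smul_shift_zpow, ← map_smul, ← map_sub]
      exact Submodule.mem_iSup_of_mem i ⟨_, S.sub_mem (hS m hm) (S.smul_mem _ hm), rfl⟩)

variable {S S' : Submodule K M} (hS : ∀ m ∈ S, H K (A := A) • m ∈ S)
  (hS' : ∀ m ∈ S', H K (A := A) • m ∈ S')

theorem mem_induced {m : M} :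
    m ∈ h.induced S hS ↔ m ∈ ⨆ i : ℤ, S.map (h.shift ^ i).val := Iff.rfl

theorem mem_induced_of_mem {m : M} (hm : m ∈ S) : m ∈ h.induced S hS := by
  rw [mem_induced]
  exact Submodule.mem_iSup_of_mem 0 ⟨m, hm, by simp⟩

theorem induced_mono (hle : S ≤ S') : h.induced S hS ≤ h.induced S' hS' := by
  intro m hm
  rw [mem_induced] at hm ⊢
  exact iSup_mono (fun i => Submodule.map_mono hle) hm

theorem map_shift_zpow_le_weight {l : K} (hl : S ≤ weight A M l) (i : ℤ) :
    S.map (h.shift ^ i).val ≤ weight A M (l - i) := by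
  rintro _ ⟨m, hm, rfl⟩
  exact h.shift_zpow_mem_weight i (hl hm)

theorem mem_iSup_weight_of_mem_induced {l : K} (hl : S ≤ weight A M l) {m : M}
    (hm : m ∈ h.induced S hS) : m ∈ ⨆ i : ℤ, weight A M (l - i) := by
  rw [mem_induced] at hm
  exact iSup_mono (fun i => h.map_shift_zpow_le_weight hl i) hm

variable [CharZero K]

/-- The summand `∂ⁱS` has weight `l - i`, and in characteristic zero these weights are distinct; a
vector of weight `l` is therefore its own component at `i = 0`. So `S` can be recovered from `⊕ᵢ
∂ⁱS`. -/
theorem mem_of_mem_induced {l : K} (hl : S ≤ weight A M l) {m : M}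
    (hm : m ∈ h.induced S hS) (hml : m ∈ weight A M l) : m ∈ S := by
  rw [mem_induced] at hm
  obtain ⟨f, hf, rfl⟩ := (Submodule.mem_iSup_iff_exists_finsupp _ _).1 hm
  have hf' := fun i => h.map_shift_zpow_le_weight hl i (hf i)
  have hi := (iSupIndep_def.1 ((iSupIndep_weight K A M).comp (sub_intCast_injective l))) 0
  have h0 : f 0 ∈ S := by simpa using hf 0
  rw [← Finsupp.add_sum_erase' f 0 (fun _ m => m) (fun _ => rfl)] at hml ⊢
  have h1 : ((f.erase 0).sum fun _ m => m) = 0 := by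
    refine Submodule.disjoint_def.1 hi _ ?_ ?_
    · simpa using Submodule.sub_mem _ hml (hl h0)
    · refine Submodule.sum_mem _ fun i hi => ?_
      have hne : i ≠ 0 := by
        rintro rfl
        simp at hi
      rw [Finsupp.erase_ne hne]
      exact Submodule.mem_iSup_of_mem i (Submodule.mem_iSup_of_mem hne (hf' i))
  rwa [h1, add_zero]

/-- A submodule is determined by its vectors of one weight if all weights are congruent. -/
theorem le_of_weight (h : DInvertible K A M) {l : K} (hW : ⨆ i : ℤ, weight A M (l - i) = ⊤)
    {N N' : Submodule A M} (hN : ∀ m ∈ weight A M l, m ∈ N → m ∈ N') : N ≤ N' := by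
  intro m hm
  have hm' : m ∈ ⨆ i : ℤ, weight A M (l - i) := by rw [hW]; trivial
  obtain ⟨f, hf, rfl⟩ := (Submodule.mem_iSup_iff_exists_finsupp _ _).1 hm'
  refine Submodule.sum_mem _ fun i _ => ?_
  -- Each weight component lies in `N`; `∂⁻ⁱ` moves it to weight `l`, where the hypothesis applies,
  -- and `∂ⁱ` moves it back.
  have h1 := mem_of_sum_mem (sub_intCast_injective l) N f hf hm i
  have h2 := hN _ (by simpa using h.shift_zpow_mem_weight (-i) (hf i))
    (h.shift_zpow_mem (-i) h1)
  have h3 := h.shift_zpow_mem (- -i) h2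
  rwa [shift_zpow_neg_apply] at h3

theorem eq_bot_of_weight (h : DInvertible K A M) {l : K} (hW : ⨆ i : ℤ, weight A M (l - i) = ⊤)
    {N : Submodule A M} (hN : ∀ m ∈ weight A M l, m ∈ N → m = 0) : N = ⊥ :=
  le_bot_iff.1 (h.le_of_weight hW fun m hm hmN => (Submodule.mem_bot A).2 (hN m hm hmN))

end DInvertible

end Shift

/-! ### Cyclic weight modules -/

section Cyclic

set_option linter.unusedSectionVars false

variable {K : Type*} [Field K] {A : Type*} [Ring A] [Algebra K A] [IntDiffAlgebra K A]

theorem aeval_H_X_sub_C (l : K) : aeval (H K : A) (X - C l) = T A l := by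
  rw [map_sub, aeval_X, aeval_C, T]

theorem aeval_H_X_sub_C_pow (l : K) (n : ℕ) : aeval (H K : A) ((X - C l) ^ n) = T A l ^ n := by
  rw [map_pow, aeval_H_X_sub_C]

variable {M : Type*} [AddCommGroup M] [Module A M]

variable (A) in
/-- `∂` acts invertibly on `M`, and `M` is generated by `u`, whose annihilator in `K[H]` is
generated by `(H - l)ⁿ`. -/
structure IsCyclicWeight (n : ℕ) (l : K) (u : M) : Prop where
  invertible : DInvertible K A M
  span : Submodule.span A {u} = ⊤
  ann : ∀ q : K[X], aeval (H K : A) q • u = 0 ↔ (X - C l) ^ n ∣ q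

variable {n : ℕ} {l : K} {u : M}

theorem IsCyclicWeight.T_pow_smul (h : IsCyclicWeight A n l u) : T A l ^ n • u = 0 := by
  rw [← aeval_H_X_sub_C_pow, h.ann]

/-- This vector generates the smallest nonzero submodule. For `n = 0` the subtraction truncates and
`u` itself is zero. -/
theorem IsCyclicWeight.T_pow_sub_one_smul (h : IsCyclicWeight A n l u) (hn : 1 ≤ n) :
    T A l ^ (n - 1) • u ≠ 0 := by
  rw [← aeval_H_X_sub_C_pow, Ne, h.ann]
  intro hd
  have := (pow_dvd_pow_iff (X_sub_C_ne_zero l) (not_isUnit_X_sub_C l)).1 hd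
  omega

variable [Module K M] [IsScalarTower K A M]
variable {N : Type*} [AddCommGroup N] [Module K N] [Module A N] [IsScalarTower K A N]

/-- If `(H - l)ⁿ u = 0`, every `q(H) u` with `(X - l)ⁿ ∤ q` can be moved to a nonzero multiple of
`(H - l)ⁿ⁻¹ u`. -/
theorem exists_T_pow_smul_aeval (hu : T A l ^ n • u = 0) {q : K[X]}
    (hq : ¬ (X - C l) ^ n ∣ q) :
    ∃ k : ℕ, ∃ c : K, c ≠ 0 ∧ T A l ^ k • aeval (H K : A) q • u = c • T A l ^ (n - 1) • u := by
  have hq0 : q ≠ 0 := by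
    rintro rfl
    exact hq (dvd_zero _)
  obtain ⟨r, hr, hr'⟩ := exists_eq_pow_rootMultiplicity_mul_and_not_dvd q hq0 l
  set k := q.rootMultiplicity l
  have hk : k < n := by
    by_contra hk
    exact hq (hr ▸ (pow_dvd_pow _ (not_lt.1 hk)).mul_right r)
  -- With `q = (X - l)ᵏ r` and `r(l) ≠ 0`, the product `(X - l)ⁿ⁻¹⁻ᵏ q = (X - l)ⁿ⁻¹ r` is congruent
  -- to `r(l)(X - l)ⁿ⁻¹` modulo `(X - l)ⁿ`.
  refine ⟨n - 1 - k, r.eval l, fun h0 => hr' (dvd_iff_isRoot.2 h0), ?_⟩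
  obtain ⟨s, hs⟩ := X_sub_C_dvd_sub_C_eval (p := r) (a := l)
  have e : (X - C l) ^ (n - 1 - k) * q =
      s * (X - C l) ^ n + C (r.eval l) * (X - C l) ^ (n - 1) := by
    have h1 : n - 1 - k + k = n - 1 := by omega
    have h2 : (X - C l) ^ n = (X - C l) ^ (n - 1) * (X - C l) := by
      rw [← pow_succ]; congr 1; omega
    rw [hr, ← mul_assoc, ← pow_add, h1, h2]
    linear_combination (X - C l) ^ (n - 1) * hs
  rw [← mul_smul, ← aeval_H_X_sub_C_pow, ← map_mul, e, map_add, map_mul, map_mul, add_smul,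
    mul_smul, aeval_H_X_sub_C_pow, hu, smul_zero, zero_add, aeval_C, mul_smul, algebraMap_smul,
    aeval_H_X_sub_C_pow]

variable (A) in
/-- The subspace `K[H] u`. -/
def orbit (u : M) : Submodule K M :=
  LinearMap.range ((LinearMap.toSpanSingleton A M u).restrictScalars K ∘ₗ
    (aeval (R := K) (H K : A)).toLinearMap)

theorem mem_orbit {u m : M} : m ∈ orbit (K := K) A u ↔ ∃ q : K[X], aeval (H K : A) q • u = m :=
  Iff.rfl

theorem self_mem_orbit (u : M) : u ∈ orbit (K := K) A u :=
  mem_orbit.2 ⟨1, by rw [map_one, one_smul]⟩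

theorem H_smul_mem_orbit (u : M) :
    ∀ m ∈ orbit (K := K) A u, H K (A := A) • m ∈ orbit (K := K) A u := by
  rintro _ ⟨q, rfl⟩
  refine mem_orbit.2 ⟨X * q, ?_⟩
  rw [map_mul, aeval_X, mul_smul]
  rfl

theorem orbit_le_weight {l : K} {u : M} (hu : u ∈ weight A M l) : orbit A u ≤ weight A M l := by
  rintro _ ⟨q, rfl⟩
  obtain ⟨n, hn⟩ := mem_weight.1 hu
  refine mem_weight.2 ⟨n, ?_⟩
  change T A l ^ n • aeval (H K : A) q • u = 0
  rw [← mul_smul, ← aeval_H_X_sub_C_pow, ← map_mul, mul_comm, map_mul, aeval_H_X_sub_C_pow,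
    mul_smul, hn, smul_zero]

namespace IsCyclicWeight

variable (h : IsCyclicWeight A n l u)

theorem mem_weight (h : IsCyclicWeight A n l u) : u ∈ weight A M l :=
  IntDiff.mem_weight.2 ⟨n, h.T_pow_smul⟩

theorem induced_eq_top : h.invertible.induced _ (H_smul_mem_orbit (K := K) (A := A) u) = ⊤ := by
  rw [eq_top_iff, ← h.span, Submodule.span_singleton_le_iff_mem]
  exact h.invertible.mem_induced_of_mem _ (self_mem_orbit u)

theorem iSup_weight (h : IsCyclicWeight A n l u) : ⨆ i : ℤ, weight A M (l - i) = ⊤ := by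
  refine eq_top_iff.2 fun m _ => ?_
  refine h.invertible.mem_iSup_weight_of_mem_induced (H_smul_mem_orbit u)
    (orbit_le_weight h.mem_weight) ?_
  rw [h.induced_eq_top]
  trivial

theorem iSup_weight_eq_top (h : IsCyclicWeight A n l u) : ⨆ l : K, weight A M l = ⊤ :=
  eq_top_iff.2 (h.iSup_weight ▸ iSup_le fun i => le_iSup (weight A M) (l - (i : K)))

theorem nontrivial (h : IsCyclicWeight A n l u) (hn : 1 ≤ n) : Nontrivial M :=
  ⟨⟨_, 0, h.T_pow_sub_one_smul hn⟩⟩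

/-- The weights of isomorphic modules are congruent. -/
theorem exists_sub_eq_intCast {n' : ℕ} {l' : K} {v : N} (h : IsCyclicWeight A n l u)
    (h' : IsCyclicWeight A n' l' v) (hn : 1 ≤ n) (e : M ≃ₗ[A] N) :
    ∃ i : ℤ, l - l' = i := by
  by_contra! hne
  have hu : e u ∈ weight A N l := IntDiff.mem_weight.2
    ⟨n, by rw [← map_smul, h.T_pow_smul, map_zero]⟩
  -- The weights `l' - i` exhaust `N`. If `l` is not among them, independence forces `e u = 0`.
  have hd := Submodule.disjoint_def.1 ((iSupIndep_weight K A N).disjoint_biSup (x := l)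
    (y := Set.range fun i : ℤ => l' - (i : K)) ?_) _ hu ?_
  · have := h.T_pow_sub_one_smul hn
    rw [(LinearEquiv.map_eq_zero_iff e).1 hd, smul_zero] at this
    exact this rfl
  · rintro ⟨i, hi⟩
    exact hne (-i) (by simp [← hi])
  · rw [iSup_range, h'.iSup_weight]
    trivial

variable [CharZero K]

theorem weight_eq (h : IsCyclicWeight A n l u) : weight A M l = orbit A u := by
  refine le_antisymm (fun m hm => ?_) (orbit_le_weight h.mem_weight)
  refine h.invertible.mem_of_mem_induced (H_smul_mem_orbit u) (orbit_le_weight h.mem_weight) ?_ hm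
  rw [h.induced_eq_top]
  trivial

theorem T_pow_smul_of_mem (h : IsCyclicWeight A n l u) {m : M} (hm : m ∈ weight A M l) :
    T A l ^ n • m = 0 := by
  rw [h.weight_eq] at hm
  obtain ⟨q, rfl⟩ := mem_orbit.1 hm
  rw [← mul_smul, ← aeval_H_X_sub_C_pow, ← map_mul, mul_comm, map_mul, aeval_H_X_sub_C_pow,
    mul_smul, h.T_pow_smul, smul_zero]

/-- Every nonzero submodule contains `(H - l)ⁿ⁻¹ u`. -/
theorem T_pow_smul_mem (h : IsCyclicWeight A n l u) {P : Submodule A M} (hP : P ≠ ⊥) :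
    T A l ^ (n - 1) • u ∈ P := by
  by_contra hu
  refine hP (h.invertible.eq_bot_of_weight h.iSup_weight fun m hm hmP => ?_)
  rw [h.weight_eq] at hm
  obtain ⟨q, rfl⟩ := mem_orbit.1 hm
  by_contra hq
  rw [h.ann] at hq
  obtain ⟨k, c, hc, hk⟩ := exists_T_pow_smul_aeval h.T_pow_smul hq
  apply hu
  have h1 := P.smul_mem (algebraMap K A c⁻¹) (P.smul_mem (T A l ^ k) hmP)
  rwa [hk, algebraMap_smul, smul_smul, inv_mul_cancel₀ hc, one_smul] at h1

/-- Any two nonzero submodules share the nonzero vector `(H - l)ⁿ⁻¹u`. -/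
theorem isIndecomposable (h : IsCyclicWeight A n l u) (hn : 1 ≤ n) : IsIndecomposable A M := by
  refine ⟨h.nontrivial hn, fun P Q hPQ => ?_⟩
  by_contra! hne
  exact h.T_pow_sub_one_smul hn (Submodule.disjoint_def.1 hPQ.disjoint _
    (h.T_pow_smul_mem hne.1) (h.T_pow_smul_mem hne.2))

/-- The weight space is `K[H]u`, and division by `(X - l)ⁿ` leaves only polynomials of degree less
than `n`. -/
theorem finite_weight (h : IsCyclicWeight A n l u) : Module.Finite K (weight A M l) := by
  rw [h.weight_eq]
  have hm : ((X - C l) ^ n).Monic := (monic_X_sub_C l).pow n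
  have hle : orbit (K := K) A u ≤ (degreeLT K n).map
      ((LinearMap.toSpanSingleton A M u).restrictScalars K ∘ₗ
        (aeval (R := K) (H K : A)).toLinearMap) := by
    intro m hm'
    obtain ⟨q, rfl⟩ := mem_orbit.1 hm'
    refine ⟨q %ₘ (X - C l) ^ n, ?_, ?_⟩
    · rw [SetLike.mem_coe, mem_degreeLT]
      simpa using degree_modByMonic_lt q hm
    · change aeval (H K : A) (q %ₘ (X - C l) ^ n) • u = aeval (H K : A) q • u
      rw [← sub_eq_zero, ← sub_smul, ← map_sub, h.ann]
      exact ⟨-(q /ₘ (X - C l) ^ n), by linear_combination modByMonic_add_div q ((X - C l) ^ n)⟩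
  have hfin : Module.Finite K (degreeLT K n) :=
    Module.Finite.equiv (degreeLTEquiv K n).symm
  have := Module.Finite.map (degreeLT K n) ((LinearMap.toSpanSingleton A M u).restrictScalars K ∘ₗ
        (aeval (R := K) (H K : A)).toLinearMap)
  exact Submodule.finiteDimensional_of_le hle

/-- The strictly monotone map `P ↦ P ∩ M^l` into the subspaces of a finite-dimensional space
transfers both chain conditions. -/
theorem isFiniteLength (h : IsCyclicWeight A n l u) : IsFiniteLength A M := by
  have := h.finite_weight
  let f : Submodule A M → Submodule K (weight A M l) := fun P =>
    (P.restrictScalars K).comap (weight A M l).subtype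
  have hf : StrictMono f := by
    refine Monotone.strictMono_of_injective (fun P Q hPQ => Submodule.comap_mono hPQ)
      fun P Q hPQ => ?_
    have hPQ' : ∀ m ∈ weight A M l, m ∈ P ↔ m ∈ Q := fun m hm => SetLike.ext_iff.1 hPQ ⟨m, hm⟩
    exact le_antisymm (h.invertible.le_of_weight h.iSup_weight fun m hm => (hPQ' m hm).1)
      (h.invertible.le_of_weight h.iSup_weight fun m hm => (hPQ' m hm).2)
  rw [isFiniteLength_iff_isNoetherian_isArtinian, isNoetherian_iff']
  exact ⟨hf.wellFoundedGT, hf.wellFoundedLT⟩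

/-- The number `n'` bounds the order of `H - l` on the weight-`l` vectors of `N`, and `e u` is such
a vector of order exactly `n`. -/
theorem le_of_equiv {n' : ℕ} {v : N} (h : IsCyclicWeight A n l u)
    (h' : IsCyclicWeight A n' l v) (e : M ≃ₗ[A] N) : n ≤ n' := by
  by_contra! hlt
  have hu : e u ∈ weight A N l := IntDiff.mem_weight.2
    ⟨n, by rw [← map_smul, h.T_pow_smul, map_zero]⟩
  have h1 := h'.T_pow_smul_of_mem hu
  rw [← map_smul, LinearEquiv.map_eq_zero_iff] at h1
  apply h.T_pow_sub_one_smul (by omega)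
  obtain ⟨k, hk⟩ := Nat.exists_eq_add_of_le' (Nat.le_sub_one_of_lt hlt)
  rw [hk, pow_add, mul_smul, h1, smul_zero]

/-- A nonzero kernel would contain `(H - l)ⁿ⁻¹u`, whose image `(H - l)ⁿ⁻¹v` is not zero; the range
contains the generator `v`. -/
theorem bijective_of_map {v : N} (h : IsCyclicWeight A n l u)
    (h' : IsCyclicWeight A n l v) (hn : 1 ≤ n) (f : M →ₗ[A] N) (hf : f u = v) :
    Function.Bijective f := by
  constructor
  · rw [← LinearMap.ker_eq_bot]
    by_contra hne
    have := h.T_pow_smul_mem hne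
    rw [LinearMap.mem_ker, map_smul, hf] at this
    exact h'.T_pow_sub_one_smul hn this
  · rw [← LinearMap.range_eq_top, eq_top_iff, ← h'.span, Submodule.span_singleton_le_iff_mem]
    exact ⟨u, hf⟩

/-- The graph of the isomorphism is generated by `(u, v)`. -/
theorem nonempty_equiv {v : N} (h : IsCyclicWeight A n l u)
    (h' : IsCyclicWeight A n l v) (hn : 1 ≤ n) : Nonempty (M ≃ₗ[A] N) := by
  let R : Submodule A (M × N) := Submodule.span A {(u, v)}
  let w : R := ⟨(u, v), Submodule.mem_span_singleton_self _⟩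
  -- The pair `(u, v)` inherits the common annihilator in `K[H]`, so both projections from the graph
  -- are bijective.
  have hw : IsCyclicWeight (K := K) A n l w := by
    refine ⟨fun m => ?_, ?_, fun q => ?_⟩
    · exact Subtype.ext (Prod.ext (h.invertible m.1.1) (h'.invertible m.1.2))
    · refine eq_top_iff.2 fun m _ => ?_
      obtain ⟨a, ha⟩ := Submodule.mem_span_singleton.1 m.2
      exact Submodule.mem_span_singleton.2 ⟨a, Subtype.ext ha⟩
    · rw [← h.ann, Subtype.ext_iff, Prod.ext_iff]
      change aeval (H K : A) q • u = 0 ∧ aeval (H K : A) q • v = 0 ↔ _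
      rw [h.ann, h'.ann, and_self]
  have h1 := hw.bijective_of_map h hn (LinearMap.fst A M N ∘ₗ R.subtype) rfl
  have h2 := hw.bijective_of_map h' hn (LinearMap.snd A M N ∘ₗ R.subtype) rfl
  exact ⟨(LinearEquiv.ofBijective _ h1).symm.trans (LinearEquiv.ofBijective _ h2)⟩

end IsCyclicWeight

end Cyclic

/-! ### Indecomposable modules -/

section Indecomposable

/-- An indecomposable module that maps onto a nonzero module with a section is isomorphic to it. -/
theorem IsIndecomposable.nonempty_equiv {R : Type*} [Ring R] {M N : Type*} [AddCommGroup M]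
    [Module R M] [AddCommGroup N] [Module R N] [Nontrivial N] (hM : IsIndecomposable R M)
    (f : M →ₗ[R] N) (g : N →ₗ[R] M) (hfg : ∀ n, f (g n) = n) : Nonempty (M ≃ₗ[R] N) := by
  have hc : IsCompl (LinearMap.range g) (LinearMap.ker f) := by
    refine ⟨Submodule.disjoint_def.2 ?_, codisjoint_iff.2 (eq_top_iff.2 fun m _ => ?_)⟩
    · rintro _ ⟨n, rfl⟩ hn
      rw [LinearMap.mem_ker, hfg] at hn
      rw [hn, map_zero]
    · refine Submodule.mem_sup.2 ⟨g (f m), ⟨_, rfl⟩, m - g (f m), ?_, by abel⟩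
      rw [LinearMap.mem_ker, map_sub, hfg, sub_self]
  rcases hM.2 _ _ hc with h | h
  · obtain ⟨n, hn⟩ := exists_ne (0 : N)
    refine absurd (hfg n) ?_
    rw [LinearMap.range_eq_bot.1 h, LinearMap.zero_apply, map_zero]
    exact hn.symm
  · exact ⟨LinearEquiv.ofBijective f ⟨LinearMap.ker_eq_bot.1 h, fun n => ⟨g n, hfg n⟩⟩⟩

variable {K : Type*} [Field K] {A : Type*} [Ring A] [Algebra K A] [IntDiffAlgebra K A]
variable {M : Type*} [AddCommGroup M] [Module K M] [Module A M] [IsScalarTower K A M]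

variable (A M) in
/-- The sum of the weight spaces with weights in a set that is closed under `± 1`. -/
def weightSubmodule (s : Set K) (hs : ∀ l ∈ s, l - 1 ∈ s) (hs' : ∀ l ∈ s, l + 1 ∈ s) :
    Submodule A M :=
  stableSubmodule A (⨆ l ∈ s, weight A M l)
    (fun _ hm => (iSup₂_le fun l hl _ hm => Submodule.mem_iSup_of_mem (l - 1)
      (Submodule.mem_iSup_of_mem (hs l hl) (d_smul_mem_weight hm)) :
        _ ≤ Submodule.comap (act K A M (d K)) (⨆ l ∈ s, weight A M l)) hm)
    (fun _ hm => (iSup₂_le fun l hl _ hm => Submodule.mem_iSup_of_mem (l + 1)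
      (Submodule.mem_iSup_of_mem (hs' l hl) (J_smul_mem_weight hm)) :
        _ ≤ Submodule.comap (act K A M (J K)) (⨆ l ∈ s, weight A M l)) hm)
    (fun _ hm => (iSup₂_le fun l hl _ hm => Submodule.mem_iSup_of_mem l
      (Submodule.mem_iSup_of_mem hl (H_smul_mem_weight hm)) :
        _ ≤ Submodule.comap (act K A M (H K)) (⨆ l ∈ s, weight A M l)) hm)

theorem mem_weightSubmodule {s : Set K} {hs hs'} {m : M} :
    m ∈ weightSubmodule A M s hs hs' ↔ m ∈ ⨆ l ∈ s, weight A M l := Iff.rfl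

/-- The weights of an indecomposable generalized weight module are congruent. -/
theorem IsIndecomposable.iSup_weight (hM : IsIndecomposable A M)
    (hW : ⨆ l : K, weight A M l = ⊤) {l : K} (hl : weight A M l ≠ ⊥) :
    ⨆ i : ℤ, weight A M (l - i) = ⊤ := by
  let s : Set K := Set.range fun i : ℤ => l - (i : K)
  have h1 : ∀ l ∈ s, l - 1 ∈ s := by
    rintro _ ⟨i, rfl⟩
    exact ⟨i + 1, by push_cast; ring⟩
  have h2 : ∀ l ∈ s, l + 1 ∈ s := by
    rintro _ ⟨i, rfl⟩
    exact ⟨i - 1, by push_cast; ring⟩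
  have h3 : ∀ l ∈ sᶜ, l - 1 ∈ sᶜ := fun l hl hl' => hl (by simpa using h2 _ hl')
  have h4 : ∀ l ∈ sᶜ, l + 1 ∈ sᶜ := fun l hl hl' => hl (by simpa using h1 _ hl')
  have hsup : (⨆ l ∈ s, weight A M l) ⊔ ⨆ l ∈ sᶜ, weight A M l = ⊤ := by
    rw [← hW, ← iSup_union, Set.union_compl_self, iSup_univ]
  -- The coset `l + ℤ` and its complement are both closed under `± 1`, so they split `M` into two
  -- submodules.
  have hc : IsCompl (weightSubmodule A M s h1 h2) (weightSubmodule A M sᶜ h3 h4) := by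
    constructor
    · refine Submodule.disjoint_def.2 fun m hm hm' => ?_
      exact Submodule.disjoint_def.1
        ((iSupIndep_weight K A M).disjoint_biSup_biSup disjoint_compl_right) m hm hm'
    · refine codisjoint_iff.2 (eq_top_iff.2 fun m _ => ?_)
      have hm : m ∈ (⨆ l ∈ s, weight A M l) ⊔ ⨆ l ∈ sᶜ, weight A M l := by rw [hsup]; trivial
      obtain ⟨a, ha, b, hb, rfl⟩ := Submodule.mem_sup.1 hm
      exact Submodule.add_mem_sup (mem_weightSubmodule.2 ha) (mem_weightSubmodule.2 hb)
  rcases hM.2 _ _ hc with h | h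
  · refine absurd (eq_bot_iff.2 fun m hm => ?_) hl
    have : m ∈ weightSubmodule A M s h1 h2 := mem_weightSubmodule.2
      (Submodule.mem_iSup_of_mem l (Submodule.mem_iSup_of_mem ⟨0, by simp⟩ hm))
    rw [h] at this
    exact this
  · have h0 : ⨆ l ∈ sᶜ, weight A M l = ⊥ := by
      refine eq_bot_iff.2 fun m hm => ?_
      have : m ∈ weightSubmodule A M sᶜ h3 h4 := mem_weightSubmodule.2 hm
      rw [h] at this
      exact this
    rw [h0, sup_bot_eq, iSup_range] at hsup
    exact hsup

/-- A subspace `K[H] u` generated by a vector of maximal order has an `H`-stable complement in the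
weight space. -/
theorem exists_complement_orbit {l : K} {n : ℕ} (hn : 1 ≤ n) {u : M} (hu : u ∈ weight A M l)
    (hT : ∀ m ∈ weight A M l, T A l ^ n • m = 0) (hu' : T A l ^ (n - 1) • u ≠ 0) :
    ∃ S ≤ weight A M l, (∀ m ∈ S, H K (A := A) • m ∈ S) ∧
      (∀ m ∈ orbit (K := K) A u, m ∈ S → m = 0) ∧
      ∀ m ∈ weight A M l, ∃ a ∈ orbit (K := K) A u, m - a ∈ S := by
  obtain ⟨g, hg⟩ := Module.Projective.exists_dual_eq_one K hu'
  have hd : ∀ k ≥ n, ∀ m ∈ weight A M l, T A l ^ k • m = 0 := by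
    intro k hk m hm
    obtain ⟨j, rfl⟩ := Nat.exists_eq_add_of_le' hk
    rw [pow_add, mul_smul, hT m hm, smul_zero]
  -- `S` is the largest `H`-stable subspace of the weight space inside `ker g`. It meets `K[H]u`
  -- trivially, since each nonzero vector there can be moved to a nonzero multiple of `(H - l)ⁿ⁻¹u`,
  -- on which `g` does not vanish.
  let S : Submodule K M := weight A M l ⊓ ⨅ k : ℕ, LinearMap.ker (g ∘ₗ act K A M (T A l ^ k))
  have hS : ∀ m, m ∈ S ↔ m ∈ weight A M l ∧ ∀ k : ℕ, g (T A l ^ k • m) = 0 := by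
    intro m
    rw [Submodule.mem_inf, Submodule.mem_iInf]
    rfl
  refine ⟨S, inf_le_left, fun m hm => ?_, fun m hm hmS => ?_, fun m hm => ?_⟩
  · rw [hS] at hm ⊢
    refine ⟨H_smul_mem_weight hm.1, fun k => ?_⟩
    have e : (H K : A) = T A l + algebraMap K A l := (sub_add_cancel _ _).symm
    rw [e, add_smul, smul_add, map_add, ← mul_smul, ← pow_succ, hm.2, algebraMap_smul, smul_comm,
      map_smul, hm.2, smul_zero, add_zero]
  · obtain ⟨q, rfl⟩ := mem_orbit.1 hm
    by_cases hq : (X - C l) ^ n ∣ q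
    · obtain ⟨r, rfl⟩ := hq
      rw [mul_comm, map_mul, mul_smul, aeval_H_X_sub_C_pow, hT u hu, smul_zero]
    · obtain ⟨k, c, hc, hk⟩ := exists_T_pow_smul_aeval (hT u hu) hq
      have := ((hS _).1 hmS).2 k
      rw [hk, map_smul, hg, smul_eq_mul, mul_one] at this
      exact absurd this hc
  -- The values `g((H - l)ᵏ(m - a))` are cleared from `k = n - 1` downwards. Subtracting `c (H -
  -- l)ʲu` lowers the value at `k = n - 1 - j` by `c` and leaves those at larger `k` alone, because
  -- `(H - l)ⁿu = 0`.
  · have key : ∀ j ≤ n, ∃ a ∈ orbit (K := K) A u, ∀ k ≥ n - j, g (T A l ^ k • (m - a)) = 0 := by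
      intro j
      induction j with
      | zero =>
        refine fun _ => ⟨0, Submodule.zero_mem _, fun k hk => ?_⟩
        rw [sub_zero, hd k (by omega) m hm, map_zero]
      | succ j ih =>
        intro hj
        obtain ⟨a, ha, hak⟩ := ih (by omega)
        set c := g (T A l ^ (n - (j + 1)) • (m - a)) with hc
        refine ⟨a + c • T A l ^ j • u,
          Submodule.add_mem _ ha (Submodule.smul_mem _ _ (mem_orbit.2
            ⟨(X - C l) ^ j, by rw [aeval_H_X_sub_C_pow]⟩)), fun k hk => ?_⟩
        rw [← sub_sub, smul_sub, map_sub, smul_comm (T A l ^ k) c, map_smul g c, ← mul_smul,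
          ← pow_add]
        rcases eq_or_lt_of_le hk with rfl | hk
        · rw [show n - (j + 1) + j = n - 1 by omega, hg, smul_eq_mul, mul_one, hc, sub_self]
        · rw [hak k (by omega), hd (k + j) (by omega) u hu, map_zero, smul_zero, sub_zero]
    obtain ⟨a, ha, hak⟩ := key n le_rfl
    exact ⟨a, ha, (hS _).2 ⟨Submodule.sub_mem _ hm (orbit_le_weight hu ha),
      fun k => hak k (by omega)⟩⟩

variable [CharZero K]

/-- The nilpotency of `H - l` on the weight space is bounded in a Noetherian module. -/
theorem DInvertible.exists_T_pow_smul [IsNoetherian A M] (h : DInvertible K A M) (l : K) :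
    ∃ n : ℕ, ∀ m ∈ weight A M l, T A l ^ n • m = 0 := by
  let S : ℕ → Submodule K M := fun k => LinearMap.ker (act K A M (T A l ^ k))
  have hS : ∀ k, ∀ m ∈ S k, H K (A := A) • m ∈ S k := fun k m hm => by
    change T A l ^ k • H K (A := A) • m = 0
    rw [← mul_smul, ← ((H_commute_T l).pow_right k).eq, mul_smul, show T A l ^ k • m = 0 from hm,
      smul_zero]
  have hSW : ∀ k, S k ≤ weight A M l := fun k m hm => mem_weight.2 ⟨k, hm⟩
  have hmono : Monotone S := by
    refine fun i j hij m hm => ?_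
    obtain ⟨k, rfl⟩ := Nat.exists_eq_add_of_le' hij
    change T A l ^ (k + i) • m = 0
    rw [pow_add, mul_smul, show T A l ^ i • m = 0 from hm, smul_zero]
  -- The kernels of `(H - l)ᵏ` are only subspaces; the submodules they induce form a chain that
  -- stabilizes, and its weight-`l` parts give the kernels back.
  obtain ⟨n, hn⟩ := monotone_stabilizes_iff_noetherian.2 ‹IsNoetherian A M›
    ⟨fun k => h.induced (S k) (hS k), fun i j hij => h.induced_mono _ _ (hmono hij)⟩
  refine ⟨n, fun m hm => ?_⟩
  obtain ⟨k, hk⟩ := mem_weight.1 hm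
  refine h.mem_of_mem_induced (hS n) (hSW n) ?_ hm
  rcases le_total k n with hkn | hkn
  · exact h.mem_induced_of_mem _ (hmono hkn hk)
  · have : m ∈ h.induced (S k) (hS k) := h.mem_induced_of_mem _ hk
    rwa [← show h.induced (S n) (hS n) = h.induced (S k) (hS k) from hn k hkn] at this

/-- An indecomposable Noetherian weight module with invertible `∂` is generated by one weight
vector. -/
theorem IsIndecomposable.exists_isCyclicWeight [IsNoetherian A M] (hM : IsIndecomposable A M)
    (h : DInvertible K A M) {l : K} (hW : ⨆ i : ℤ, weight A M (l - i) = ⊤) :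
    ∃ n : ℕ, 1 ≤ n ∧ ∃ u : M, IsCyclicWeight A n l u := by
  classical
  have hex := h.exists_T_pow_smul l
  set n := Nat.find hex with hndef
  have hT : ∀ m ∈ weight A M l, T A l ^ n • m = 0 := Nat.find_spec hex
  have hn : 1 ≤ n := by
    by_contra hn
    rw [show n = 0 by omega] at hT
    have hbot : (⊤ : Submodule A M) = ⊥ :=
      h.eq_bot_of_weight hW fun m hm _ => by simpa using hT m hm
    have := hM.1
    exact top_ne_bot hbot
  obtain ⟨u, hu, hu'⟩ : ∃ u ∈ weight A M l, T A l ^ (n - 1) • u ≠ 0 := by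
    have := Nat.find_min hex (m := n - 1) (by omega)
    push Not at this
    exact this
  obtain ⟨S, hSW, hS, hdisj, hsup⟩ := exists_complement_orbit hn hu hT hu'
  -- The decomposition `M^l = K[H]u ⊕ S` spreads over all weights; as `u ≠ 0`, indecomposability
  -- then leaves `S = 0`.
  have hc : IsCompl (h.induced _ (H_smul_mem_orbit (K := K) (A := A) u)) (h.induced S hS) := by
    constructor
    · refine disjoint_iff.2 (h.eq_bot_of_weight hW fun m hm hm' => ?_)
      exact hdisj m (h.mem_of_mem_induced _ (orbit_le_weight hu) hm'.1 hm)
        (h.mem_of_mem_induced hS hSW hm'.2 hm)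
    · refine codisjoint_iff.2 (eq_top_iff.2 (h.le_of_weight hW fun m hm _ => ?_))
      obtain ⟨a, ha, hma⟩ := hsup m hm
      rw [← add_sub_cancel a m]
      exact Submodule.add_mem_sup (h.mem_induced_of_mem _ ha) (h.mem_induced_of_mem hS hma)
  have hu0 : u ≠ 0 := by
    rintro rfl
    exact hu' (smul_zero _)
  have hS0 : ∀ m ∈ S, m = 0 := by
    intro m hm
    rcases hM.2 _ _ hc with h0 | h0
    · have : u ∈ h.induced _ (H_smul_mem_orbit (K := K) (A := A) u) :=
        h.mem_induced_of_mem _ (self_mem_orbit u)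
      rw [h0] at this
      exact absurd this hu0
    · have : m ∈ h.induced S hS := h.mem_induced_of_mem _ hm
      rw [h0] at this
      exact this
  refine ⟨n, hn, u, h, ?_, fun q => ⟨fun hq => ?_, ?_⟩⟩
  · refine eq_top_iff.2 (h.le_of_weight hW fun m hm _ => ?_)
    obtain ⟨a, ha, hma⟩ := hsup m hm
    rw [sub_eq_zero.1 (hS0 _ hma)]
    obtain ⟨q, rfl⟩ := mem_orbit.1 ha
    exact Submodule.smul_mem _ _ (Submodule.mem_span_singleton_self u)
  · by_contra hq'
    obtain ⟨k, c, hc, hk⟩ := exists_T_pow_smul_aeval (hT u hu) hq'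
    rw [hq, smul_zero] at hk
    exact smul_ne_zero hc hu' hk.symm
  · rintro ⟨r, rfl⟩
    rw [mul_comm, map_mul, mul_smul, aeval_H_X_sub_C_pow, hT u hu, smul_zero]

end Indecomposable

/-! ### The module `K[x]` -/

section Evaluation

variable {K : Type*} [Field K] {A : Type*} [Ring A] [Algebra K A] [IntDiffAlgebra K A]

variable (K A) in
/-- The idempotent `1 - ∫∂`. -/
def ev : A := 1 - J K * d K

theorem ev_mul_J : ev K A * J K = 0 := by
  rw [ev, sub_mul, mul_assoc, d_mul_J, one_mul, mul_one, sub_self]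

theorem ev_mul_H : ev K A * H K = ev K A := one_sub_mul_H

/-- `H` commutes with `∫∂`, since `H∫∂ = ∫(H + 1)∂ = ∫∂H`. -/
theorem H_mul_ev : H K * ev K A = ev K A := by
  nth_rewrite 2 [← ev_mul_H]
  rw [ev, mul_sub, mul_one, ← mul_assoc, H_mul_J, mul_assoc, ← d_mul_H, sub_mul, one_mul, mul_assoc]

theorem d_pow_mul_H (k : ℕ) : (d K : A) ^ k * H K = (H K + k) * d K ^ k := by
  induction k with
  | zero => simp
  | succ k ih =>
    rw [pow_succ, mul_assoc, d_mul_H, ← mul_assoc, mul_add, ih, Nat.cast_succ]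
    noncomm_ring

/-- On `K[x]` the operator `(1 - ∫∂)∂ᵏ` reads off the `k`-th Taylor coefficient, up to `k!`; hence
the eigenvalue `k + 1`, the weight of `xᵏ`. -/
theorem ev_mul_d_pow_mul_H (k : ℕ) :
    ev K A * d K ^ k * H K = algebraMap K A (k + 1) * (ev K A * d K ^ k) := by
  rw [mul_assoc, d_pow_mul_H, ← mul_assoc, mul_add, ev_mul_H, ← Nat.cast_comm, map_add, map_one,
    map_natCast]
  noncomm_ring

theorem ev_mul_d_pow_mul_T (k : ℕ) (l : K) :
    ev K A * d K ^ k * T A l = algebraMap K A (k + 1 - l) * (ev K A * d K ^ k) := by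
  rw [T, mul_sub, ev_mul_d_pow_mul_H, ← Algebra.commutes, ← sub_mul, ← map_sub]

theorem ev_mul_d_pow_mul_T_pow (k : ℕ) (l : K) (n : ℕ) :
    ev K A * d K ^ k * T A l ^ n = algebraMap K A ((k + 1 - l) ^ n) * (ev K A * d K ^ k) := by
  induction n with
  | zero => simp
  | succ n ih =>
    rw [pow_succ, ← mul_assoc, ih, mul_assoc, ev_mul_d_pow_mul_T, ← mul_assoc, ← map_mul, pow_succ]

variable {M : Type*} [AddCommGroup M] [Module A M]

theorem ev_smul_of_d_smul_eq_zero {v : M} (hv : d K (A := A) • v = 0) : ev K A • v = v := by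
  rw [ev, sub_smul, mul_smul, hv, smul_zero, one_smul, sub_zero]

theorem H_smul_of_d_smul_eq_zero {v : M} (hv : d K (A := A) • v = 0) :
    H K (A := A) • v = v := by
  conv_lhs => rw [← ev_smul_of_d_smul_eq_zero hv, ← mul_smul, H_mul_ev]
  exact ev_smul_of_d_smul_eq_zero hv

theorem H_smul_J_pow_smul_of_d_smul_eq_zero {v : M} (hv : d K (A := A) • v = 0) (k : ℕ) :
    H K (A := A) • J K (A := A) ^ k • v = algebraMap K A (k + 1) • J K (A := A) ^ k • v := by
  induction k with
  | zero => simp [H_smul_of_d_smul_eq_zero hv]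
  | succ k ih =>
    rw [pow_succ', mul_smul, ← mul_smul, H_mul_J, mul_smul, add_smul, one_smul, ih, smul_add,
      ← mul_smul, ← Algebra.commutes, mul_smul, Nat.cast_succ, map_add _ ((k : K) + 1), map_one,
      add_smul, one_smul]

variable [Module K M] [IsScalarTower K A M]

theorem ev_smul_d_pow_smul_of_mem_weight {l : K} {m : M} (hm : m ∈ weight A M l) {k : ℕ}
    (hk : (k + 1 : K) ≠ l) : (ev K A * d K ^ k) • m = 0 := by
  obtain ⟨n, hn⟩ := mem_weight.1 hm
  have h1 := congrArg (· • m) (ev_mul_d_pow_mul_T_pow (A := A) k l n)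
  simp only [mul_smul, hn, smul_zero, algebraMap_smul] at h1
  rw [mul_smul]
  exact ((smul_eq_zero.1 h1.symm).resolve_left (pow_ne_zero n (sub_ne_zero.2 hk)))

/-- A vector of weight `l` is seen only by the at most one `k` with `k + 1 = l`, and every `m` is a
finite sum of weight vectors. So Taylor expansions are polynomials. -/
theorem exists_forall_ev_smul_d_pow_smul [CharZero K] (hW : ⨆ l : K, weight A M l = ⊤) (m : M) :
    ∃ n : ℕ, ∀ k ≥ n, (ev K A * d K ^ k) • m = 0 := by
  have hm : m ∈ ⨆ l : K, weight A M l := by rw [hW]; trivial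
  induction hm using Submodule.iSup_induction' with
  | mem l m hm =>
    by_cases h : ∃ k : ℕ, (k + 1 : K) = l
    · obtain ⟨k, rfl⟩ := h
      refine ⟨k + 1, fun j hj => ev_smul_d_pow_smul_of_mem_weight hm fun hjk => ?_⟩
      have := Nat.cast_injective (add_right_cancel hjk)
      omega
    · push Not at h
      exact ⟨0, fun j _ => ev_smul_d_pow_smul_of_mem_weight hm (h j)⟩
  | zero => exact ⟨0, fun _ _ => smul_zero _⟩
  | add a b _ _ ha hb =>
    obtain ⟨i, hi⟩ := ha
    obtain ⟨j, hj⟩ := hb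
    exact ⟨max i j, fun k hk => by
      rw [smul_add, hi k (le_of_max_le_left hk), hj k (le_of_max_le_right hk), add_zero]⟩

end Evaluation

/-! ### Simplicity of `K[x]`, and how it splits off from a weight module -/

section Polynomials

theorem coeff_opInt_zero {K : Type*} [Field K] (p : K[X]) : (opInt K p).coeff 0 = 0 := by
  induction p using Polynomial.induction_on' with
  | add p q hp hq => rw [map_add, coeff_add, hp, hq, add_zero]
  | monomial n a => rw [opInt_monomial, coeff_monomial, if_neg (Nat.succ_ne_zero n)]

theorem coeff_opInt_succ {K : Type*} [Field K] (p : K[X]) (k : ℕ) :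
    (opInt K p).coeff (k + 1) = p.coeff k * ((k : K) + 1)⁻¹ := by
  induction p using Polynomial.induction_on' with
  | add p q hp hq => rw [map_add, coeff_add, hp, hq, coeff_add, add_mul]
  | monomial n a =>
    rw [opInt_monomial, coeff_monomial, coeff_monomial]
    by_cases h : n = k
    · simp [h]
    · simp [h]

/-- `K[x]` with the natural action of `∂`, `∫` and `H`. -/
class NaturalAction (K : Type*) (A : Type*) [Field K] [Ring A] [Algebra K A] [IntDiffAlgebra K A]
    [Module A K[X]] : Prop extends IsScalarTower K A K[X] where
  d_smul : ∀ p : K[X], d K (A := A) • p = derivative p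
  J_smul : ∀ p : K[X], J K (A := A) • p = opInt K p
  H_smul_monomial : ∀ (n : ℕ) (a : K), H K (A := A) • monomial n a = monomial n (a * (n + 1))

open NaturalAction

instance (K : Type u) [Field K] [CharZero K] : NaturalAction K (I1 K) where
  smul_assoc _ _ _ := rfl
  d_smul _ := rfl
  J_smul _ := rfl
  H_smul_monomial := I1.H_apply_monomial K

variable {K : Type*} [Field K] {A : Type*} [Ring A] [Algebra K A] [IntDiffAlgebra K A]
variable [Module A K[X]] [NaturalAction K A]

theorem coeff_H_smul (p : K[X]) (k : ℕ) : (H K (A := A) • p).coeff k = (k + 1) * p.coeff k := by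
  induction p using Polynomial.induction_on' with
  | add p q hp hq => rw [smul_add, coeff_add, coeff_add, hp, hq, mul_add]
  | monomial n a =>
    rw [H_smul_monomial, coeff_monomial, coeff_monomial]
    split_ifs with h
    · rw [h, mul_comm]
    · rw [mul_zero]

variable (K A) in
theorem iSup_weight_polynomial : ⨆ l : K, weight A K[X] l = ⊤ := by
  refine eq_top_iff.2 fun p _ => ?_
  induction p using Polynomial.induction_on' with
  | add p q hp hq => exact Submodule.add_mem _ (hp trivial) (hq trivial)
  | monomial n a =>
    refine Submodule.mem_iSup_of_mem ((n : K) + 1) (mem_weight.2 ⟨1, ?_⟩)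
    rw [pow_one, T, sub_smul, H_smul_monomial, algebraMap_smul, smul_monomial, smul_eq_mul,
      mul_comm, sub_self]

variable [CharZero K]

/-- Differentiation lowers the degree, and in characteristic zero it kills only constants, so it
ends at a nonzero constant. -/
theorem one_mem_of_mem {N : Submodule A K[X]} {p : K[X]} (hp : p ∈ N) (hp0 : p ≠ 0) :
    (1 : K[X]) ∈ N := by
  induction hn : p.natDegree using Nat.strong_induction_on generalizing p with
  | _ n ih =>
    rcases Nat.eq_zero_or_pos n with rfl | hpos
    · rw [eq_C_of_natDegree_eq_zero hn] at hp hp0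
      have h := N.smul_mem (algebraMap K A (p.coeff 0)⁻¹) hp
      rwa [algebraMap_smul, smul_C, smul_eq_mul, inv_mul_cancel₀ (by simpa using hp0)] at h
    · refine ih _ ?_ (N.smul_mem (d K) hp) (fun h => ?_) rfl
      · rw [← hn]
        exact (congrArg natDegree (d_smul (A := A) p)).trans_lt (natDegree_derivative_lt (by omega))
      · have := derivative_eq_zero.1 ((d_smul (A := A) p).symm.trans h)
        omega

theorem eq_top_of_one_mem {N : Submodule A K[X]} (h : (1 : K[X]) ∈ N) : N = ⊤ := by
  have hX : ∀ n : ℕ, (X : K[X]) ^ n ∈ N := by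
    intro n
    induction n with
    | zero => simpa using h
    | succ n ih =>
      have h1 := N.smul_mem (J K) (N.smul_mem (H K) ih)
      rwa [X_pow_eq_monomial, H_smul_monomial, J_smul, opInt_monomial, one_mul,
        mul_inv_cancel₀ (Nat.cast_add_one_ne_zero n), ← X_pow_eq_monomial] at h1
  refine eq_top_iff.2 fun p _ => ?_
  induction p using Polynomial.induction_on' with
  | add p q hp hq => exact N.add_mem (hp trivial) (hq trivial)
  | monomial n a =>
    have := N.smul_mem (algebraMap K A a) (hX n)
    rwa [algebraMap_smul, smul_eq_C_mul, C_mul_X_pow_eq_monomial] at this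

variable (K A) in
theorem isSimpleModule_polynomial : IsSimpleModule A K[X] := by
  refine (isSimpleModule_iff _ _).2 { eq_bot_or_eq_top := fun N => ?_ }
  by_cases hN : N = ⊥
  · exact .inl hN
  · obtain ⟨p, hp, hp0⟩ := N.ne_bot_iff.1 hN
    exact .inr (eq_top_of_one_mem (one_mem_of_mem hp hp0))

variable (K A) in
theorem isFiniteLength_polynomial : IsFiniteLength A K[X] := by
  have := isSimpleModule_polynomial K A
  exact isFiniteLength_iff_isNoetherian_isArtinian.2 ⟨inferInstance, inferInstance⟩

variable (K A) in
theorem isIndecomposable_polynomial : IsIndecomposable A K[X] := by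
  have := isSimpleModule_polynomial K A
  refine ⟨inferInstance, fun P Q hPQ => ?_⟩
  rcases eq_bot_or_eq_top P with h | h
  · exact .inl h
  · exact .inr (by simpa [h] using hPQ.inf_eq_bot)

variable {M : Type*} [AddCommGroup M] [Module K M] [Module A M] [IsScalarTower K A M]

/-- The homomorphism `K[x] → M` with `1 ↦ v`, for `v` in the kernel of `∂`. -/
theorem exists_hom_of_d_smul_eq_zero {v : M} (hv : d K (A := A) • v = 0) :
    ∃ f : K[X] →ₗ[A] M, f 1 = v := by
  -- Forced by `xⁿ = n! ∫ⁿ1` in `K[x]`.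
  let f : K[X] →ₗ[K] M := (Polynomial.basisMonomials K).constr K fun n =>
    (n.factorial : K) • J K (A := A) ^ n • v
  have hf : ∀ (n : ℕ) (a : K), f (monomial n a) =
      (a * n.factorial) • J K (A := A) ^ n • v := by
    intro n a
    have h : (monomial n a : K[X]) = a • Polynomial.basisMonomials K n := by
      simp [Polynomial.smul_monomial]
    rw [h, map_smul, Module.Basis.constr_basis, smul_smul]
  have hcomm : ∀ a : A, (∀ n c, f (a • monomial n c) = a • f (monomial n c)) →
      ∀ p, f (a • p) = a • f p := by
    intro a ha p
    induction p using Polynomial.induction_on' with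
    | add p q hp hq => rw [smul_add, map_add, map_add, smul_add, hp, hq]
    | monomial n c => exact ha n c
  refine ⟨homOfCommute A f (hcomm _ fun n c => ?_) (hcomm _ fun n c => ?_)
    (hcomm _ fun n c => ?_), ?_⟩
  · rw [d_smul, derivative_monomial, hf, hf, smul_comm (d K : A) (_ : K)]
    rcases n with _ | n
    · simp [hv]
    · rw [pow_succ' _ n, mul_smul (J K : A), d_smul_J_smul, Nat.add_sub_cancel, Nat.factorial_succ]
      push_cast
      rw [mul_assoc]
  · rw [J_smul, opInt_monomial, hf, hf, smul_comm (J K : A) (_ : K), ← mul_smul (J K),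
      ← pow_succ']
    congr 1
    have := Nat.cast_add_one_ne_zero (R := K) n
    rw [Nat.factorial_succ]
    push_cast
    field_simp
  · rw [H_smul_monomial, hf, hf, smul_comm (H K : A) (_ : K),
      H_smul_J_pow_smul_of_d_smul_eq_zero hv, algebraMap_smul, smul_smul]
    congr 1
    ring
  · rw [homOfCommute_apply]
    have := hf 0 1
    simpa using this

/-- The Taylor expansion `m ↦ ∑ₖ g(ev(∂ᵏ m)) xᵏ / k!`. -/
theorem exists_taylor (hW : ⨆ l : K, weight A M l = ⊤) (g : M →ₗ[K] K) :
    ∃ f : M →ₗ[A] K[X], ∀ m k,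
      (f m).coeff k = g ((ev K A * d K ^ k) • m) / k.factorial := by
  have hex : ∀ m : M, ∃ p : K[X], ∀ k,
      p.coeff k = g ((ev K A * d K ^ k) • m) / k.factorial := by
    intro m
    obtain ⟨n, hn⟩ := exists_forall_ev_smul_d_pow_smul hW m
    refine ⟨∑ k ∈ Finset.range n,
      monomial k (g ((ev K A * d K ^ k) • m) / k.factorial), fun k => ?_⟩
    simp only [finsetSum_coeff, coeff_monomial, Finset.sum_ite_eq', Finset.mem_range]
    split_ifs with hk
    · rfl
    · rw [hn k (not_lt.1 hk), map_zero, zero_div]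
  choose f hf using hex
  let F : M →ₗ[K] K[X] :=
    { toFun := f
      map_add' := fun a b => by
        ext k
        rw [coeff_add, hf, hf, hf, smul_add, map_add, add_div]
      map_smul' := fun c a => by
        ext k
        rw [RingHom.id_apply, coeff_smul, hf, hf, smul_comm, map_smul, smul_eq_mul, smul_eq_mul,
          mul_div_assoc] }
  have hF : ∀ m k, (F m).coeff k = g ((ev K A * d K ^ k) • m) / k.factorial := hf
  refine ⟨homOfCommute A F (fun m => ?_) (fun m => ?_) (fun m => ?_), hf⟩
  · ext k
    have := Nat.cast_add_one_ne_zero (R := K) k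
    rw [d_smul, coeff_derivative, hF, hF, ← mul_smul, mul_assoc, ← pow_succ,
      Nat.factorial_succ]
    push_cast
    field_simp
  · ext k
    rw [J_smul, hF]
    rcases k with _ | k
    -- The relation `(1 - ∫∂)∫ = 0` matches the vanishing constant term of an integral.
    · rw [coeff_opInt_zero, pow_zero, mul_one, ← mul_smul, ev_mul_J, zero_smul, map_zero, zero_div]
    · rw [coeff_opInt_succ, hF, ← mul_smul, pow_succ, mul_assoc, mul_assoc, d_mul_J, mul_one,
        Nat.factorial_succ]
      push_cast
      field_simp
  · ext k
    rw [coeff_H_smul, hF, hF, ← mul_smul, ev_mul_d_pow_mul_H, mul_smul, algebraMap_smul, map_smul,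
      smul_eq_mul, mul_div_assoc]

/-- An indecomposable generalized weight module on which `∂` is not injective is `K[x]`. -/
theorem IsIndecomposable.nonempty_equiv_polynomial (hM : IsIndecomposable A M)
    (hW : ⨆ l : K, weight A M l = ⊤) {v : M} (hv : d K (A := A) • v = 0) (hv0 : v ≠ 0) :
    Nonempty (M ≃ₗ[A] K[X]) := by
  obtain ⟨g, hg⟩ := Module.Projective.exists_dual_eq_one K hv0
  obtain ⟨f, hf⟩ := exists_hom_of_d_smul_eq_zero hv
  obtain ⟨t, ht⟩ := exists_taylor hW g
  refine hM.nonempty_equiv t f fun p => ?_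
  -- The constant term of the expansion of `v` is `g(v) = 1`, and `∂v = 0` kills the others. The
  -- equalizer of `t ∘ₗ f` and the identity thus contains `1`, which generates `K[x]`.
  have h1 : t (f 1) = 1 := by
    ext k
    rw [hf, ht]
    rcases k with _ | k
    · simp [ev_smul_of_d_smul_eq_zero hv, hg]
    · rw [pow_succ, mul_smul, mul_smul, hv]
      simp [coeff_one]
  have h2 : LinearMap.eqLocus (t ∘ₗ f) LinearMap.id = ⊤ := eq_top_of_one_mem h1
  have h3 : p ∈ LinearMap.eqLocus (t ∘ₗ f) LinearMap.id := by rw [h2]; trivial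
  exact h3

end Polynomials

/-! ### The modules `M(n, l)` are cyclic -/

section Model

open TensorProduct

variable (K : Type u) [Field K]

theorem B1.ofPoly_C (c : K) : B1.ofPoly K (C c) = algebraMap K (B1 K) c := rfl

theorem B1.single_eq (i : ℤ) (p : K[X]) :
    (SkewMonoidAlgebra.single (Multiplicative.ofAdd i) p : B1 K) = B1.ofPoly K p * B1.dpow K i := by
  change _ = SkewMonoidAlgebra.single 1 p * SkewMonoidAlgebra.single (Multiplicative.ofAdd i) 1
  rw [SkewMonoidAlgebra.single_mul_single, one_mul, one_smul, mul_one]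

theorem B1.aeval_ofPoly_X (q : K[X]) : aeval (B1.ofPoly K X) q = B1.ofPoly K q := by
  induction q using Polynomial.induction_on' with
  | add p q hp hq => rw [map_add, map_add, hp, hq]
  | monomial n a =>
    rw [← C_mul_X_pow_eq_monomial, map_mul, map_pow, aeval_C, aeval_X, map_mul, map_pow,
      B1.ofPoly_C]

/-- An element of `B₁` as an element of the bimodule. -/
def B1Right.mk (b : B1 K) : B1Right K := b

/-- The coefficient of `∂⁰`, which is linear for the right action of `K[H]`. -/
def B1Right.coeffZero : B1Right K →ₗ[K[X]] K[X] where
  toFun b := (show B1 K from b).coeff 1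
  map_add' b c := by
    have h : ∀ b c : B1 K, (b + c).coeff 1 = b.coeff 1 + c.coeff 1 := fun b c => by simp
    exact h b c
  map_smul' p b := by
    change ((show B1 K from b) * SkewMonoidAlgebra.single 1 p).coeff 1 = p * _
    rw [SkewMonoidAlgebra.coeff_mul_single_one, one_smul, mul_comm]

theorem B1Right.coeffZero_one : B1Right.coeffZero K (B1Right.mk K 1) = 1 := by
  classical
  change (SkewMonoidAlgebra.single 1 1 : B1 K).coeff 1 = 1
  rw [SkewMonoidAlgebra.coeff_single_apply, if_pos rfl]

variable {K}

/-- The element `b ⊗ q` of `M(n, l)`. -/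
def Mod.mk (n : ℕ) (l : K) (b : B1 K) (q : K[X] ⧸ Ideal.span {(X - C l : K[X]) ^ n}) : Mod K n l :=
  B1Right.mk K b ⊗ₜ[K[X]] q

theorem Mod.smul_mk (n : ℕ) (l : K) (b c : B1 K) (q : K[X] ⧸ Ideal.span {(X - C l : K[X]) ^ n}) :
    b • Mod.mk n l c q = Mod.mk n l (b * c) q := rfl

theorem Mod.mk_quotientMk (n : ℕ) (l : K) (b : B1 K) (p : K[X]) :
    Mod.mk n l b (Ideal.Quotient.mk _ p) = Mod.mk n l (b * B1.ofPoly K p) 1 := by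
  have h : Ideal.Quotient.mk (Ideal.span {(X - C l : K[X]) ^ n}) p = p • 1 := by
    change Submodule.Quotient.mk p = p • Submodule.Quotient.mk 1
    rw [← Submodule.Quotient.mk_smul, smul_eq_mul, mul_one]
  rw [h]
  exact (TensorProduct.smul_tmul p (B1Right.mk K b) 1).symm

theorem Mod.ofPoly_smul_eq_zero_iff (n : ℕ) (l : K) (p : K[X]) :
    B1.ofPoly K p • Mod.mk n l 1 1 = 0 ↔ (X - C l) ^ n ∣ p := by
  rw [← Ideal.mem_span_singleton, ← Ideal.Quotient.eq_zero_iff_mem, Mod.smul_mk, mul_one,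
    ← one_mul (B1.ofPoly K p), ← Mod.mk_quotientMk]
  -- Taking the coefficient of `∂⁰` retracts `B₁` onto `K[H]`; after tensoring it sends `1 ⊗ q` to
  -- `q`, so no relation is added in weight `l`.
  let f := (TensorProduct.lid K[X] (K[X] ⧸ Ideal.span {(X - C l : K[X]) ^ n})).toLinearMap ∘ₗ
    LinearMap.rTensor _ (B1Right.coeffZero K)
  constructor
  · intro h0
    have h1 : ∀ q, f (B1Right.mk K 1 ⊗ₜ[K[X]] q) = q := fun q => by
      simp [f, B1Right.coeffZero_one]
    exact (h1 _).symm.trans ((congrArg f h0).trans (map_zero f))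
  · intro h0
    rw [h0]
    exact TensorProduct.tmul_zero _ _

variable (K)
variable [CharZero K]

theorem toB1_aeval_H (q : K[X]) : toB1 K (aeval (I1.H K) q) = B1.ofPoly K q := by
  rw [← aeval_algHom_apply, toB1_H, B1.aeval_ofPoly_X]

/-- The image contains every `∂ⁱ` and `K[H]`, whose products span `B₁`. Hence a `B₁`-generator of
`M(n, l)` also generates it over `𝕀₁`. -/
theorem toB1_surjective : Function.Surjective (toB1 K) := by
  have hd : ∀ i : ℤ, B1.dpow K i ∈ (toB1 K).range := by
    intro i
    induction i using Int.induction_on with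
    | zero => exact one_mem _
    | succ i ih =>
      rw [← B1.dpow_mul_dpow]
      exact mul_mem ih ⟨_, toB1_d K⟩
    | pred i ih =>
      rw [sub_eq_add_neg, ← B1.dpow_mul_dpow]
      exact mul_mem ih ⟨_, toB1_int K⟩
  have hp : ∀ p : K[X], B1.ofPoly K p ∈ (toB1 K).range := by
    intro p
    exact ⟨_, toB1_aeval_H K p⟩
  suffices h : ∀ b : B1 K, b ∈ (toB1 K).range from h
  intro b
  induction b using SkewMonoidAlgebra.induction_on with
  | zero => exact zero_mem _
  | single g p =>
    have := B1.single_eq K g.toAdd p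
    rw [ofAdd_toAdd] at this
    rw [this]
    exact mul_mem (hp p) (hd _)
  | add f g hf hg => exact add_mem hf hg

variable {K}

theorem Mod.smul_def {n : ℕ} {l : K} (a : I1 K) (m : Mod K n l) : a • m = toB1 K a • m := rfl

instance (n : ℕ) (l : K) : Module K (Mod K n l) := Module.compHom _ (algebraMap K (I1 K))

instance (n : ℕ) (l : K) : IsScalarTower K (I1 K) (Mod K n l) :=
  .of_algebraMap_smul fun _ _ => rfl

theorem Mod.isCyclicWeight (n : ℕ) (l : K) : IsCyclicWeight (I1 K) n l (Mod.mk n l 1 1) where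
  invertible m := by
    change toB1 K (I1.int K) • toB1 K (I1.d K) • m = m
    rw [toB1_int, toB1_d, ← mul_smul, B1.dpow_mul_dpow]
    exact one_smul (B1 K) m
  span := by
    refine eq_top_iff.2 fun m _ => ?_
    induction m using TensorProduct.induction_on with
    | zero => exact Submodule.zero_mem _
    | tmul b q =>
      obtain ⟨p, rfl⟩ := Ideal.Quotient.mk_surjective q
      obtain ⟨a, ha⟩ := toB1_surjective K ((show B1 K from b) * B1.ofPoly K p)
      refine Submodule.mem_span_singleton.2 ⟨a, ?_⟩
      rw [Mod.smul_def, ha, Mod.smul_mk, mul_one]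
      exact (Mod.mk_quotientMk n l b p).symm
    | add a b ha hb => exact Submodule.add_mem _ (ha trivial) (hb trivial)
  ann q := by
    rw [← Mod.ofPoly_smul_eq_zero_iff, ← toB1_aeval_H]
    rfl

end Model

end IntDiff

end

/-! ### The classification theorem -/

open IntDiff

theorem mainTheorem1 (K : Type u) [Field K] [CharZero K] (Λ : Set K)
    (hΛ : Function.Bijective
      (fun l : Λ => (QuotientAddGroup.mk (l : K) : K ⧸ (Int.castAddHom K).range))) :
    (∀ (M : Type v) [AddCommGroup M] [Module (IntDiff.I1 K) M],
      IntDiff.IsIndecomposable (IntDiff.I1 K) M → IntDiff.IsGenWeight K M →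
      IsFiniteLength (IntDiff.I1 K) M →
        Nonempty (M ≃ₗ[IntDiff.I1 K] K[X]) ∨
          ∃ n : ℕ, 1 ≤ n ∧ ∃ l ∈ Λ, Nonempty (M ≃ₗ[IntDiff.I1 K] IntDiff.Mod K n l)) ∧
    (IntDiff.IsIndecomposable (IntDiff.I1 K) K[X] ∧ IntDiff.IsGenWeight K K[X] ∧
      IsFiniteLength (IntDiff.I1 K) K[X]) ∧
    (∀ n : ℕ, 1 ≤ n → ∀ l ∈ Λ,
      IntDiff.IsIndecomposable (IntDiff.I1 K) (IntDiff.Mod K n l) ∧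
      IntDiff.IsGenWeight K (IntDiff.Mod K n l) ∧
      IsFiniteLength (IntDiff.I1 K) (IntDiff.Mod K n l)) ∧
    (∀ n : ℕ, 1 ≤ n → ∀ l ∈ Λ, IsEmpty (K[X] ≃ₗ[IntDiff.I1 K] IntDiff.Mod K n l)) ∧
    (∀ n m : ℕ, 1 ≤ n → 1 ≤ m → ∀ l ∈ Λ, ∀ l' ∈ Λ,
      Nonempty (IntDiff.Mod K n l ≃ₗ[IntDiff.I1 K] IntDiff.Mod K m l') → n = m ∧ l = l') := by
  refine ⟨fun M _ _ hM hW hfl => ?_,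
    ⟨isIndecomposable_polynomial K (I1 K), isGenWeight_iff.2 (iSup_weight_polynomial K (I1 K)),
      isFiniteLength_polynomial K (I1 K)⟩, fun n hn l _ => ?_, fun n _ l _ => ⟨fun e => ?_⟩,
    fun n m hn hm l hl l' hl' => ?_⟩
  · let : Module K M := Module.compHom M (algebraMap K (I1 K))
    have : IsScalarTower K (I1 K) M := .of_algebraMap_smul fun _ _ => rfl
    rw [isGenWeight_iff] at hW
    obtain ⟨hN, -⟩ := isFiniteLength_iff_isNoetherian_isArtinian.1 hfl
    by_cases hd : ∀ m : M, I1.d K • m = 0 → m = 0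
    · right
      have hinv : DInvertible K (I1 K) M := J_smul_d_smul_of_injective (K := K) (A := I1 K) hd
      obtain ⟨μ, hμ⟩ : ∃ μ : K, weight (I1 K) M μ ≠ ⊥ := by
        by_contra! h
        have := hM.1
        rw [iSup_eq_bot.2 h] at hW
        exact bot_ne_top hW
      have hμW := hM.iSup_weight hW hμ
      obtain ⟨⟨l, hl⟩, hlμ⟩ := hΛ.2 (QuotientAddGroup.mk μ)
      obtain ⟨j, hj⟩ := QuotientAddGroup.eq.1 hlμ
      -- The representative `l ∈ Λ` satisfies `μ = l + j`, so shifting the index by `j` turns one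
      -- family of weights into the other.
      have hlW : ⨆ i : ℤ, weight (I1 K) M (l - i) = ⊤ := by
        rw [← hμW, ← (Equiv.subRight j).iSup_comp]
        congr 1
        funext i
        congr 1
        replace hj : (j : K) = -l + μ := hj
        simp only [Equiv.subRight_apply]
        push_cast
        rw [hj]
        ring
      obtain ⟨n, hn, u, hu⟩ := hM.exists_isCyclicWeight hinv hlW
      exact ⟨n, hn, l, hl, hu.nonempty_equiv (Mod.isCyclicWeight n l) hn⟩
    · push Not at hd
      obtain ⟨v, hv, hv0⟩ := hd
      exact .inl (hM.nonempty_equiv_polynomial hW hv hv0)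
  · have h := Mod.isCyclicWeight n l
    exact ⟨h.isIndecomposable hn, isGenWeight_iff.2 h.iSup_weight_eq_top, h.isFiniteLength⟩
  -- `∂` kills `1 ∈ K[x]` but acts invertibly on `M(n, l)`.
  · have h1 : I1.d K • (1 : K[X]) = 0 := derivative_one
    have h2 : I1.int K • I1.d K • e 1 = e 1 := (Mod.isCyclicWeight n l).invertible (e 1)
    rw [← map_smul, h1, map_zero, smul_zero] at h2
    exact one_ne_zero ((LinearEquiv.map_eq_zero_iff e).1 h2.symm)
  · rintro ⟨e⟩
    have h := Mod.isCyclicWeight n l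
    have h' := Mod.isCyclicWeight m l'
    obtain ⟨i, hi⟩ := h.exists_sub_eq_intCast h' hn e
    have hll : l = l' := by
      have heq : (⟨l', hl'⟩ : Λ) = ⟨l, hl⟩ := hΛ.1 (QuotientAddGroup.eq.2 ⟨i, by
        rw [neg_add_eq_sub, hi]
        rfl⟩)
      exact (congrArg Subtype.val heq).symm
    subst hll
    exact ⟨le_antisymm (h.le_of_equiv h' e) (h'.le_of_equiv h e.symm), rfl⟩
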